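/- Let $0\le p\le n$, let $\langle x,y\rangle_p=-\sum_{j=1}^p x_jy_j+\sum_{j=p+1}^n x_jy_j$ on $\mathbb R^n$, and let $\mathbb C^n$ be endowed with the pseudo-Hermitian form $\langle\langle z,w\rangle\rangle_p=-\sum_{j=1}^p z_j\bar w_j+\sum_{j=p+1}^n z_j\bar w_j$, the pseudo-Riemannian metric $\mathrm{Re}\,\langle\langle\cdot,\cdot\rangle\rangle_p$ and the symplectic form $\omega_p=-\mathrm{Im}\,\langle\langle\cdot,\cdot\rangle\rangle_p$. Let $M$ be an invertible real $n\times n$ matrix which is self-adjoint with respect to $\langle\cdot,\cdot\rangle_p$, and let $c\in\mathbb R$ be such that the quadric $$\mathcal S=\{x\in\mathbb R^n : x\neq 0,\ \langle x,Mx\rangle_p=c\}$$ (the condition $x\ne0$ only matters if $c=0$, where it removes the vertex of the cone) is a non-empty non-degenerate hypersurface of $(\mathbb R^n,\langle\cdot,\cdot\rangle_p)$, i.e. $\langle\cdot,\cdot\rangle_p$ is non-degenerate on each tangent space of $\mathcal S$. Let $r$ be a positive smooth function on a non-empty open interval $I\subset\mathbb R$, and $$f:I\times\mathcal S\to\mathbb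 C^n,\qquad f(s,x)=r(s)\,e^{iMs}x .$$ Then $f$ is a Lagrangian immersion ($f^*\omega_p=0$), and $f$ is minimal, i.e. its induced metric is non-degenerate and it is a critical point of the volume with respect to compactly supported variations, if and only if (at least) one of the following holds: (i) $\mathrm{tr}\,M=0$ and the function $r$ is constant; (ii) $\mathrm{tr}\,M=0$ and $c=0$; (iii) up to a congruence $z\mapsto Az+b$ of $\mathbb C^n$, where $b\in\mathbb C^n$ and $A$ is a complex linear map preserving $\langle\langle\cdot,\cdot\rangle\rangle_p$, the image of $f$ is a part of a Lagrangian catenoid $$\{\gamma x : x\in\mathbb R^n,\ \langle x,x\rangle_p=\epsilon,\ \gamma\in\mathbb C,\ \mathrm{Im}\,\gamma^n=C\}$$ for some $\epsilon\in\{1,-1\}$ and some real constant $C\neq0$. -/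

import Mathlib

open scoped ContDiff Matrix

noncomputable section

namespace EvolvingQuadric

/-- The signs of the form of signature `(p, n - p)`: `-1` for the first `p` indices, then `+1`. -/
def sgn {n : ℕ} (p : ℕ) (j : Fin n) : ℝ := if (j : ℕ) < p then -1 else 1

/-- The scalar product `⟨x, y⟩_p = -∑_{j ≤ p} x_j y_j + ∑_{j > p} x_j y_j` of `ℝⁿ`. -/
def realForm {n : ℕ} (p : ℕ) (x y : Fin n → ℝ) : ℝ := ∑ j, sgn p j * (x j * y j)

/-- The pseudo-Hermitian form `⟪z, w⟫_p = -∑_{j ≤ p} z_j w̄_j + ∑_{j > p} z_j w̄_j` of `ℂⁿ`. -/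
def herm {n : ℕ} (p : ℕ) (z w : Fin n → ℂ) : ℂ :=
  ∑ j, (sgn p j : ℂ) * (z j * (starRingEnd ℂ) (w j))

/-- The pseudo-Riemannian metric `⟨z, w⟩_{2p} = Re ⟪z, w⟫_p` of `ℂⁿ`. -/
def metric {n : ℕ} (p : ℕ) (z w : Fin n → ℂ) : ℝ := (herm p z w).re

/-- The symplectic form `ω_p = - Im ⟪·, ·⟫_p` of `ℂⁿ`. -/
def symplecticForm {n : ℕ} (p : ℕ) (z w : Fin n → ℂ) : ℝ := -(herm p z w).im

/-! ### The quadric -/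

/-- The (smooth part of the) quadric `{x ∈ ℝⁿ | ⟨x, M x⟩_p = c}`. The condition `x ≠ 0` is automatic
for `c ≠ 0`; for `c = 0` it removes the vertex of the cone, where the quadric is not a
hypersurface. -/
def quadric {n : ℕ} (p : ℕ) (M : Matrix (Fin n) (Fin n) ℝ) (c : ℝ) : Set (Fin n → ℝ) :=
  {x | realForm p x (M *ᵥ x) = c ∧ x ≠ 0}

/-- The quadric is a non-degenerate hypersurface of `(ℝⁿ, ⟨·,·⟩_p)`: it is not empty and the form
induced on every tangent space `{v | ⟨v, M x⟩_p = 0}` is non-degenerate. (For `M` invertible and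
self-adjoint, the differential `v ↦ 2 ⟨v, M x⟩_p` of `x ↦ ⟨x, M x⟩_p` does not vanish at the points
of the quadric, which is therefore a smooth hypersurface with these tangent spaces.) -/
def QuadricNondegenerate {n : ℕ} (p : ℕ) (M : Matrix (Fin n) (Fin n) ℝ) (c : ℝ) : Prop :=
  (quadric p M c).Nonempty ∧
    ∀ x ∈ quadric p M c, ∀ v : Fin n → ℝ, realForm p v (M *ᵥ x) = 0 →
      (∀ w : Fin n → ℝ, realForm p w (M *ᵥ x) = 0 → realForm p v w = 0) → v = 0

/-- The map `f(s, x) = r(s) e^{iMs} x`. -/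
def evolvingMap {n : ℕ} (M : Matrix (Fin n) (Fin n) ℝ) (r : ℝ → ℝ) :
    ℝ × (Fin n → ℝ) → (Fin n → ℂ) := fun q =>
  (r q.1 : ℂ) •
    (NormedSpace.exp ((Complex.I * (q.1 : ℂ)) • M.map (fun a : ℝ => (a : ℂ))) *ᵥ
      fun j => (q.2 j : ℂ))

/-! ### Volume and minimality -/

/-- The Gram matrix `⟨∂_i F, ∂_j F⟩_{2p}` of the metric induced by `F` on the parameter domain. -/
def inducedMetric {n : ℕ} (p : ℕ) (F : (Fin n → ℝ) → (Fin n → ℂ)) (u : Fin n → ℝ) :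
    Matrix (Fin n) (Fin n) ℝ :=
  Matrix.of fun i j =>
    metric p (fderiv ℝ F u (Pi.single i 1)) (fderiv ℝ F u (Pi.single j 1))

/-- The volume density `|det ⟨∂_i F, ∂_j F⟩_{2p}|^{1/2}`. -/
def volumeDensity {n : ℕ} (p : ℕ) (F : (Fin n → ℝ) → (Fin n → ℂ)) (u : Fin n → ℝ) : ℝ :=
  Real.sqrt |(inducedMetric p F u).det|

/-- `F : U → ℂⁿ` is a critical point of the volume with respect to compactly supported variations:
for every smooth variation `Φ t`, `|t| < δ`, of `Φ 0 = F` which agrees with `F` outside of a compact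
subset `K` of `U`, the volume of `Φ t` over `K` has derivative `0` at `t = 0`. -/
def IsVolumeCritical {n : ℕ} (p : ℕ) (U : Set (Fin n → ℝ)) (F : (Fin n → ℝ) → (Fin n → ℂ)) :
    Prop :=
  ∀ (δ : ℝ) (K : Set (Fin n → ℝ)) (Φ : ℝ → (Fin n → ℝ) → (Fin n → ℂ)),
    0 < δ → IsCompact K → K ⊆ U →
    ContDiffOn ℝ ∞ (fun q : ℝ × (Fin n → ℝ) => Φ q.1 q.2) (Set.Ioo (-δ) δ ×ˢ U) →
    (∀ u ∈ U, Φ 0 u = F u) →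
    (∀ t ∈ Set.Ioo (-δ) δ, ∀ u ∈ U \ K, Φ t u = F u) →
    HasDerivAt (fun t : ℝ => ∫ u in K, volumeDensity p (Φ t) u) 0 0

/-- `ψ : U → D` is a local parametrization of the `n`-dimensional submanifold
`D` of `ℝ × ℝⁿ`. -/
structure IsLocalParametrization {n : ℕ} (D : Set (ℝ × (Fin n → ℝ))) (U : Set (Fin n → ℝ))
    (ψ : (Fin n → ℝ) → ℝ × (Fin n → ℝ)) : Prop where
  isOpen : IsOpen U
  contDiffOn : ContDiffOn ℝ ∞ ψ U
  mapsTo : Set.MapsTo ψ U D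
  injOn : Set.InjOn ψ U
  injective_fderiv : ∀ u ∈ U, Function.Injective (fderiv ℝ ψ u)

/-- `f : D → ℂⁿ` is a Lagrangian immersion: in all local parametrizations it is a smooth map with
injective differential, and the pull-back of `ω_p` vanishes. -/
def IsLagrangianImmersion {n : ℕ} (p : ℕ) (D : Set (ℝ × (Fin n → ℝ)))
    (f : ℝ × (Fin n → ℝ) → (Fin n → ℂ)) : Prop :=
  ∀ U ψ, IsLocalParametrization D U ψ →
    ContDiffOn ℝ ∞ (f ∘ ψ) U ∧
    ∀ u ∈ U, Function.Injective (fderiv ℝ (f ∘ ψ) u) ∧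
      ∀ v w, symplecticForm p (fderiv ℝ (f ∘ ψ) u v) (fderiv ℝ (f ∘ ψ) u w) = 0

/-- The immersion `f : D → (ℂⁿ, ⟪·,·⟫_p)` is non-degenerate (the induced metric is non-degenerate)
and a critical point of the volume with respect to compactly supported variations. Since being
critical is a condition on the first variation, which is linear in the variation field, it is enough
to ask for it in the domains of the local parametrizations. -/
def IsMinimal {n : ℕ} (p : ℕ) (D : Set (ℝ × (Fin n → ℝ)))
    (f : ℝ × (Fin n → ℝ) → (Fin n → ℂ)) : Prop :=
  ∀ U ψ, IsLocalParametrization D U ψ →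
    (∀ u ∈ U, (inducedMetric p (f ∘ ψ) u).det ≠ 0) ∧ IsVolumeCritical p U (f ∘ ψ)

/-! ### The Lagrangian catenoid -/

/-- The Lagrangian catenoid `{γ x | x ∈ ℝⁿ, ⟨x, x⟩_p = ε, γ ∈ ℂ, Im γⁿ = C}`. -/
def lagrangianCatenoid (n p : ℕ) (ε C : ℝ) : Set (Fin n → ℂ) :=
  {z | ∃ (γ : ℂ) (x : Fin n → ℝ),
    realForm p x x = ε ∧ (γ ^ n).im = C ∧ z = γ • fun j => (x j : ℂ)}

/-- `L` is, up to a congruence of `(ℂⁿ, ⟪·,·⟫_p)` (a translation composed with an element of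
`U(p, n - p)`), a part of a Lagrangian catenoid, with `ε = ±1` and a non-vanishing constant `C`. -/
def IsPartOfLagrangianCatenoid {n : ℕ} (p : ℕ) (L : Set (Fin n → ℂ)) : Prop :=
  ∃ ε C : ℝ, (ε = 1 ∨ ε = -1) ∧ C ≠ 0 ∧
    ∃ (A : (Fin n → ℂ) →ₗ[ℂ] (Fin n → ℂ)) (b : Fin n → ℂ),
      (∀ z w, herm p (A z) (A w) = herm p z w) ∧
      L ⊆ (fun z => A z + b) '' lagrangianCatenoid n p ε C

end EvolvingQuadric

end

/-!
Lagrangian immersions have a phase: if `D = det_ℂ (∂_1 F, …, ∂_n F)` is the complex Jacobian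
determinant of a Lagrangian immersion `F` of an open set of `ℝⁿ` into `ℂⁿ`, then the Gram
determinant of the induced metric is `±|D|²`, and the argument of `D` is the Lagrangian angle. The
first variation of the volume at `F` is that of the integral of `Re (conj D / |D| · det_ℂ)`
(`hasDerivAt_sqrt_abs_det_gram`). As the cofactors of a Jacobian matrix are divergence free
(`sum_fderiv_mul_det_updateRow_jac`), integration by parts leaves only the derivatives of
`conj D / |D|`, so that `F` is critical if and only if its Lagrangian angle is locally constant
(`isVolumeCritical_iff`).

For `f(s, x) = r(s) e^{iMs} x`, the matrix `e^{iMs}` is pseudo-unitary, and `D` is a non-zero real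
function times `det(e^{iMs}) (ρ c + i ⟨M x, M x⟩)` with `ρ = r' / r` (`jacDet_evolvingMap_comp`).
The non-degeneracy of the quadric says that `⟨M x, M x⟩ ≠ 0`, so `D ≠ 0`. Since the logarithmic
derivative of `det(e^{iMs})` is `i tr M`, minimality amounts to the two equations of
`isMinimal_evolvingMap_iff`: with `μ = ⟨M x, M x⟩`,
`tr M (c² ρ² + μ²) = c μ ρ'`, and `c ρ dμ = 0` on the tangent spaces of the quadric.

If `c = 0` or `ρ = 0`, these equations reduce to `tr M = 0`. Otherwise the second one makes every
point of the quadric an eigenvector of `M`, whence `M = κ Id` (`eq_smul_one_of_eigenvectors`), and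
the first one becomes `ρ' = n (ρ² + κ²)`; it integrates to `Im (γⁿ / P) = const` for `γ = r e^{iκs}`
and some complex constant `P` (`exists_im_pow_eq_const`), which is a rotated Lagrangian catenoid.
Conversely, the complex Jacobian determinant of a map into a Lagrangian catenoid is real
(`im_jacDet_eq_zero_of_mapsTo_lagrangianCatenoid`), so that a Lagrangian immersion into a congruent
copy has constant Lagrangian angle.
-/

namespace EvolvingQuadric

/-! ### Derivatives of determinants -/

theorem hasDerivAt_re {f : ℝ → ℂ} {f' : ℂ} {t : ℝ} (h : HasDerivAt f f' t) :
    HasDerivAt (fun s => (f s).re) f'.re t :=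
  Complex.reCLM.hasFDerivAt.comp_hasDerivAt t h

theorem det_map_ofReal {n : ℕ} (B : Matrix (Fin n) (Fin n) ℝ) :
    (B.map (fun a : ℝ => (a : ℂ))).det = (B.det : ℂ) :=
  (RingHom.map_det Complex.ofRealHom B).symm

theorem hasDerivAt_det {n : ℕ} {A : ℝ → Matrix (Fin n) (Fin n) ℂ} {A' : Matrix (Fin n) (Fin n) ℂ}
    {t : ℝ} (h : ∀ i j, HasDerivAt (fun s => A s i j) (A' i j) t) :
    HasDerivAt (fun s => (A s).det) (∑ i, ((A t).updateRow i (A' i)).det) t := by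
  let f : ContinuousMultilinearMap ℝ (fun _ : Fin n => Fin n → ℂ) ℂ :=
    { toMultilinearMap :=
        ((Matrix.detRowAlternating (R := ℂ) (n := Fin n)).toMultilinearMap).restrictScalars ℝ
      cont := Continuous.matrix_det continuous_id }
  have hA : HasDerivAt (fun s => (A s : Fin n → Fin n → ℂ)) A' t :=
    hasDerivAt_pi.2 fun i => hasDerivAt_pi.2 fun j => h i j
  have := (f.hasFDerivAt (A t)).comp_hasDerivAt t hA
  exact this.congr_deriv (ContinuousMultilinearMap.linearDeriv_apply f (A t) A')

theorem contDiffOn_det {n : ℕ} {𝕜 : Type*} [NormedField 𝕜] [NormedAlgebra ℝ 𝕜]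
    {X : Type*} [NormedAddCommGroup X] [NormedSpace ℝ X]
    {A : X → Matrix (Fin n) (Fin n) 𝕜} {s : Set X} {m : WithTop ℕ∞}
    (h : ∀ i j, ContDiffOn ℝ m (fun x => A x i j) s) :
    ContDiffOn ℝ m (fun x => (A x).det) s := by
  simp_rw [Matrix.det_apply]
  refine ContDiffOn.sum fun σ _ => ?_
  exact (contDiffOn_prod fun i _ => h _ _).const_smul _

theorem sgn_mul_self {n : ℕ} (p : ℕ) (j : Fin n) : sgn p j * sgn p j = 1 := by
  unfold sgn; split_ifs <;> simp

theorem prod_sgn_eq {n : ℕ} (p : ℕ) :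
    (∏ j : Fin n, sgn p j) = 1 ∨ (∏ j : Fin n, sgn p j) = -1 := by
  refine mul_self_eq_one_iff.1 ?_
  rw [← Finset.prod_mul_distrib]
  exact Finset.prod_eq_one fun j _ => sgn_mul_self p j

theorem det_herm_gram {n : ℕ} (p : ℕ) (E : Matrix (Fin n) (Fin n) ℂ) :
    (Matrix.of fun i j => herm p (E i) (E j)).det =
      (((∏ j : Fin n, sgn p j) * Complex.normSq E.det : ℝ) : ℂ) := by
  have : (Matrix.of fun i j => herm p (E i) (E j)) =
      E * Matrix.diagonal (fun j => (sgn p j : ℂ)) * Eᴴ := by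
    ext i j
    rw [Matrix.mul_apply]
    simp only [Matrix.of_apply, herm, Matrix.mul_diagonal, Matrix.conjTranspose_apply]
    refine Finset.sum_congr rfl fun k _ => ?_
    simp only [RCLike.star_def]
    ring
  rw [this, Matrix.det_mul, Matrix.det_mul, Matrix.det_diagonal, Matrix.det_conjTranspose,
    RCLike.star_def]
  push_cast
  rw [Complex.normSq_eq_conj_mul_self]
  ring

theorem map_ofReal_metric_gram {n : ℕ} (p : ℕ) {E : Matrix (Fin n) (Fin n) ℂ}
    (hlag : ∀ i j, (herm p (E i) (E j)).im = 0) :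
    (Matrix.of fun i j => metric p (E i) (E j)).map (fun a : ℝ => (a : ℂ)) =
      Matrix.of fun i j => herm p (E i) (E j) := by
  ext i j
  apply Complex.ext
  · simp [metric]
  · simp [hlag]

theorem det_metric_gram {n : ℕ} (p : ℕ) {E : Matrix (Fin n) (Fin n) ℂ}
    (hlag : ∀ i j, (herm p (E i) (E j)).im = 0) :
    (Matrix.of fun i j => metric p (E i) (E j)).det =
      (∏ j : Fin n, sgn p j) * Complex.normSq E.det := by
  have := det_herm_gram p E
  rw [← map_ofReal_metric_gram p hlag, det_map_ofReal] at this
  exact_mod_cast this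

/-- The volume density along a curve of matrices, at a matrix whose rows span a non-degenerate
Lagrangian subspace. The determinant of the real Gram matrix has the same first derivative as the
determinant of the Hermitian one, which is `±|det|²`, because the differential of the determinant at
a real matrix commutes with taking real parts. -/
theorem hasDerivAt_sqrt_abs_det_gram {n : ℕ} (p : ℕ) {E : ℝ → Matrix (Fin n) (Fin n) ℂ}
    {E' : Matrix (Fin n) (Fin n) ℂ} {t : ℝ}
    (h : ∀ i j, HasDerivAt (fun s => E s i j) (E' i j) t)
    (hlag : ∀ i j, (herm p (E t i) (E t j)).im = 0) (hdet : (E t).det ≠ 0) :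
    HasDerivAt
      (fun s => Real.sqrt |(Matrix.of fun i j => metric p (E s i) (E s j)).det|)
      (((starRingEnd ℂ) (E t).det / (‖(E t).det‖ : ℂ) *
        ∑ i, ((E t).updateRow i (E' i)).det).re) t := by
  set H : ℝ → Matrix (Fin n) (Fin n) ℂ := fun s => Matrix.of fun i j => herm p (E s i) (E s j)
    with hH
  set G : ℝ → Matrix (Fin n) (Fin n) ℝ := fun s => Matrix.of fun i j => metric p (E s i) (E s j)
    with hG
  set ε : ℝ := ∏ j : Fin n, sgn p j with hε
  have hε1 : ε = 1 ∨ ε = -1 := prod_sgn_eq p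
  have hε2 : ε * ε = 1 := mul_self_eq_one_iff.2 hε1
  have hdetH : ∀ s, (H s).det = ((ε * Complex.normSq (E s).det : ℝ) : ℂ) :=
    fun s => det_herm_gram p (E s)
  set H' : Matrix (Fin n) (Fin n) ℂ := Matrix.of fun i j =>
    herm p (E' i) (E t j) + herm p (E t i) (E' j) with hH'
  have hHd : ∀ i j, HasDerivAt (fun s => H s i j) (H' i j) t := by
    intro i j
    have : HasDerivAt (fun s => ∑ k, (sgn p k : ℂ) * (E s i k * (starRingEnd ℂ) (E s j k)))
        (∑ k, (sgn p k : ℂ) * (E' i k * (starRingEnd ℂ) (E t j k) +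
          E t i k * (starRingEnd ℂ) (E' j k))) t := by
      refine HasDerivAt.fun_sum fun k _ => ?_
      exact ((h i k).mul (h j k).star).const_mul _
    simpa [hH, hH', herm, mul_add, Finset.sum_add_distrib] using this
  have hGd : ∀ i j, HasDerivAt (fun s => ((G s).map (fun a : ℝ => (a : ℂ))) i j)
      (((H'.map Complex.re).map (fun a : ℝ => (a : ℂ))) i j) t :=
    fun i j => (hasDerivAt_re (hHd i j)).ofReal_comp
  have hG0 : (G t).map (fun a : ℝ => (a : ℂ)) = H t := map_ofReal_metric_gram p hlag
  -- Row by row, the imaginary part of `H'` contributes a purely imaginary determinant, since the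
  -- other rows of `H t` are real.
  have hre : ∀ i, ((H t).updateRow i (H' i)).det.re =
      ((H t).updateRow i ((H'.map Complex.re).map (fun a : ℝ => (a : ℂ)) i)).det.re := by
    intro i
    have hsplit : H' i = (H'.map Complex.re).map (fun a : ℝ => (a : ℂ)) i +
        Complex.I • (H'.map Complex.im).map (fun a : ℝ => (a : ℂ)) i := by
      ext j
      simp [mul_comm Complex.I, Complex.re_add_im]
    have hreal : ((H t).updateRow i ((H'.map Complex.im).map (fun a : ℝ => (a : ℂ)) i)) =
        ((G t).updateRow i ((H'.map Complex.im) i)).map (fun a : ℝ => (a : ℂ)) := by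
      rw [← hG0]
      ext j k
      by_cases hj : j = i
      · subst hj; simp
      · simp [hj]
    conv_lhs => rw [hsplit]
    rw [Matrix.det_updateRow_add, Matrix.det_updateRow_smul, hreal, det_map_ofReal]
    simp
  have dG' : HasDerivAt (fun s => (G s).det)
      (∑ i, ((H t).updateRow i (H' i)).det).re t := by
    have := hasDerivAt_re (hasDerivAt_det hGd)
    rw [hG0] at this
    simp only [Complex.re_sum, ← hre, det_map_ofReal, Complex.ofReal_re] at this
    simpa only [Complex.re_sum] using this
  have dE := hasDerivAt_det h
  set S := ∑ i, ((E t).updateRow i (E' i)).det with hS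
  set d := (E t).det with hd
  have dN : HasDerivAt (fun s => ε * Complex.normSq (E s).det)
      (ε * (2 * ((starRingEnd ℂ) d * S).re)) t := by
    have h1 : HasDerivAt (fun s => (starRingEnd ℂ) (E s).det * (E s).det)
      ((starRingEnd ℂ) S * d + (starRingEnd ℂ) d * S) t := dE.star.mul dE
    have h2 := (hasDerivAt_re h1).const_mul ε
    simp only [← Complex.normSq_eq_conj_mul_self, Complex.ofReal_re] at h2
    refine h2.congr_deriv ?_
    simp only [Complex.add_re, Complex.mul_re, Complex.conj_re, Complex.conj_im]
    ring
  have hval : (∑ i, ((H t).updateRow i (H' i)).det).re =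
      ε * (2 * ((starRingEnd ℂ) d * S).re) := by
    have h1 := hasDerivAt_re (hasDerivAt_det hHd)
    simp only [hdetH, Complex.ofReal_re] at h1
    exact h1.unique dN
  rw [hval] at dG'
  have hNpos : 0 < Complex.normSq d := Complex.normSq_pos.2 hdet
  have hG' : HasDerivAt (fun s => ε * (G s).det) (2 * ((starRingEnd ℂ) d * S).re) t := by
    have := dG'.const_mul ε
    rwa [← mul_assoc ε ε, hε2, one_mul] at this
  have hval0 : ε * (G t).det = Complex.normSq d := by
    rw [show (G t).det = ε * Complex.normSq d from det_metric_gram p hlag, ← mul_assoc, hε2,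
      one_mul]
  have hpos0 : 0 < ε * (G t).det := by rwa [hval0]
  have hev : (fun s => Real.sqrt |(G s).det|) =ᶠ[nhds t] fun s => Real.sqrt (ε * (G s).det) := by
    have : ∀ᶠ s in nhds t, 0 < ε * (G s).det :=
      hG'.continuousAt.eventually (lt_mem_nhds hpos0)
    filter_upwards [this] with s hs
    rw [← abs_of_pos hs, abs_mul]
    rcases hε1 with h | h <;> simp [h]
  refine ((hG'.sqrt hpos0.ne').congr_of_eventuallyEq hev).congr_deriv ?_
  have hn : ‖d‖ ≠ 0 := norm_ne_zero_iff.2 hdet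
  rw [hval0, show Real.sqrt (Complex.normSq d) = ‖d‖ from rfl, div_mul_eq_mul_div,
    Complex.div_ofReal_re]
  field_simp

/-! ### Complex Jacobians and differentiation under the integral sign -/

/-- The complex Jacobian matrix of `F : ℝⁿ → ℂⁿ`; its `i`-th row is the partial derivative
`∂_i F`. -/
noncomputable def jac {n : ℕ} (F : (Fin n → ℝ) → (Fin n → ℂ)) (u : Fin n → ℝ) :
    Matrix (Fin n) (Fin n) ℂ :=
  Matrix.of fun i => fderiv ℝ F u (Pi.single i 1)

/-- The complex Jacobian determinant `det_ℂ (∂_1 F, …, ∂_n F)`. For a Lagrangian immersion, its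
argument is the Lagrangian angle. -/
noncomputable def jacDet {n : ℕ} (F : (Fin n → ℝ) → (Fin n → ℂ)) (u : Fin n → ℝ) : ℂ :=
  (jac F u).det

theorem clm_apply_eq_sum_single {n : ℕ} {Y : Type*} [NormedAddCommGroup Y] [NormedSpace ℝ Y]
    (L : (Fin n → ℝ) →L[ℝ] Y) (v : Fin n → ℝ) : L v = ∑ i, v i • L (Pi.single i 1) := by
  conv_lhs => rw [← ContinuousLinearMap.coe_coe, LinearMap.pi_apply_eq_sum_univ]
  refine Finset.sum_congr rfl fun j _ => ?_
  have hs : (fun i => if j = i then (1 : ℝ) else 0) = Pi.single j 1 := by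
    ext i; simp [Pi.single_apply, eq_comm]
  rw [hs, ContinuousLinearMap.coe_coe]

theorem hasDerivAt_line {n : ℕ} {Y : Type*} [NormedAddCommGroup Y] [NormedSpace ℝ Y]
    {g : (Fin n → ℝ) → Y} {u : Fin n → ℝ} (hg : DifferentiableAt ℝ g u) (v : Fin n → ℝ) :
    HasDerivAt (fun t : ℝ => g (u + t • v)) (fderiv ℝ g u v) 0 := by
  have hline : HasDerivAt (fun t : ℝ => u + t • v) v 0 := by
    simpa using ((hasDerivAt_id (0 : ℝ)).smul_const v).const_add u
  refine HasFDerivAt.comp_hasDerivAt (f := fun t : ℝ => u + t • v) 0 ?_ hline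
  simpa using hg.hasFDerivAt

theorem eventually_line_mem {n : ℕ} {U : Set (Fin n → ℝ)} (hU : IsOpen U) {u : Fin n → ℝ}
    (hu : u ∈ U) (v : Fin n → ℝ) : ∀ᶠ t : ℝ in nhds 0, u + t • v ∈ U := by
  have hcont : ContinuousAt (fun t : ℝ => u + t • v) 0 := by fun_prop
  exact hcont.eventually_mem (hU.mem_nhds (by simpa using hu))

theorem contDiffOn_fderiv_apply {X Y : Type*} [NormedAddCommGroup X] [NormedSpace ℝ X]
    [NormedAddCommGroup Y] [NormedSpace ℝ Y] {f : X → Y} {U : Set X} (hU : IsOpen U)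
    (hf : ContDiffOn ℝ ∞ f U) (v : X) : ContDiffOn ℝ ∞ (fun u => fderiv ℝ f u v) U :=
  (hf.fderiv_of_isOpen hU (by simp)).clm_apply contDiffOn_const

theorem contDiffOn_jac {n : ℕ} {F : (Fin n → ℝ) → (Fin n → ℂ)} {U : Set (Fin n → ℝ)}
    (hU : IsOpen U) (hF : ContDiffOn ℝ ∞ F U) (i j : Fin n) :
    ContDiffOn ℝ ∞ (fun u => jac F u i j) U :=
  contDiffOn_pi.1 (contDiffOn_fderiv_apply hU hF (Pi.single i 1)) j

theorem contDiffOn_jacDet {n : ℕ} {F : (Fin n → ℝ) → (Fin n → ℂ)} {U : Set (Fin n → ℝ)}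
    (hU : IsOpen U) (hF : ContDiffOn ℝ ∞ F U) : ContDiffOn ℝ ∞ (jacDet F) U :=
  contDiffOn_det fun i j => contDiffOn_jac hU hF i j

theorem contDiffOn_det_updateRow_jac {n : ℕ} {F X : (Fin n → ℝ) → (Fin n → ℂ)}
    {U : Set (Fin n → ℝ)} (hU : IsOpen U) (hF : ContDiffOn ℝ ∞ F U) (hX : ContDiffOn ℝ ∞ X U)
    (i : Fin n) : ContDiffOn ℝ ∞ (fun u => ((jac F u).updateRow i (X u)).det) U := by
  refine contDiffOn_det fun j k => ?_
  simp only [Matrix.updateRow_apply]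
  split_ifs
  · exact contDiffOn_pi.1 hX k
  · exact contDiffOn_jac hU hF j k

theorem hasDerivAt_setIntegral_of_contDiffOn {X : Type*} [NormedAddCommGroup X] [NormedSpace ℝ X]
    [MeasurableSpace X] [BorelSpace X] {μ : MeasureTheory.Measure X}
    [MeasureTheory.IsFiniteMeasureOnCompacts μ]
    {v : ℝ → X → ℝ} {W : Set (ℝ × X)} (hW : IsOpen W) {K : Set X} (hK : IsCompact K)
    (h0 : ∀ u ∈ K, ((0 : ℝ), u) ∈ W)
    (hv : ContDiffOn ℝ 1 (fun q : ℝ × X => v q.1 q.2) W) :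
    HasDerivAt (fun t => ∫ u in K, v t u ∂μ) (∫ u in K, deriv (fun t => v t u) 0 ∂μ) 0 := by
  have hd : ∀ q ∈ W, HasDerivAt (fun t => v t q.2)
      (fderiv ℝ (fun q : ℝ × X => v q.1 q.2) q (1, 0)) q.1 := by
    intro q hq
    have h1 : HasFDerivAt (fun q : ℝ × X => v q.1 q.2)
        (fderiv ℝ (fun q : ℝ × X => v q.1 q.2) q) (q.1, q.2) :=
      ((hv.differentiableOn one_ne_zero).differentiableAt (hW.mem_nhds hq)).hasFDerivAt
    have h2 : HasDerivAt (fun t : ℝ => (t, q.2)) ((1 : ℝ), (0 : X)) q.1 :=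
      (hasDerivAt_id q.1).prodMk (hasDerivAt_const _ _)
    exact HasFDerivAt.comp_hasDerivAt (f := fun t : ℝ => (t, q.2)) q.1 h1 h2
  have hcont : ContinuousOn
      (fun q => fderiv ℝ (fun q : ℝ × X => v q.1 q.2) q (1, 0)) W :=
    (hv.continuousOn_fderiv_of_isOpen hW le_rfl).clm_apply continuousOn_const
  obtain ⟨a, b, ha, -, ha0, hKb, hab⟩ := generalized_tube_lemma
    (isCompact_singleton (x := (0 : ℝ))) hK hW
    (by rintro ⟨t, u⟩ ⟨ht, hu⟩; rw [Set.mem_singleton_iff] at ht; subst ht; exact h0 u hu)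
  obtain ⟨ε, hε, hεa⟩ := Metric.nhds_basis_closedBall.mem_iff.1
    (ha.mem_nhds (ha0 (Set.mem_singleton _)))
  have hsub : Metric.closedBall (0 : ℝ) ε ×ˢ K ⊆ W := (Set.prod_mono hεa hKb).trans hab
  have hcomp : IsCompact (Metric.closedBall (0 : ℝ) ε ×ˢ K) :=
    (isCompact_closedBall 0 ε).prod hK
  obtain ⟨C, hC⟩ := hcomp.exists_bound_of_continuousOn (hcont.mono hsub)
  have hslice : ∀ t ∈ Metric.closedBall (0 : ℝ) ε, ContinuousOn (v t) K := by
    intro t ht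
    exact hv.continuousOn.comp (f := fun u => (t, u)) (by fun_prop) fun u hu => hsub ⟨ht, hu⟩
  have h0ball : (0 : ℝ) ∈ Metric.closedBall (0 : ℝ) ε := Metric.mem_closedBall_self hε.le
  have hmain := (hasDerivAt_integral_of_dominated_loc_of_deriv_le (μ := μ.restrict K)
    (F := v) (F' := fun t u => fderiv ℝ (fun q : ℝ × X => v q.1 q.2) (t, u) (1, 0))
    (bound := fun _ => C) (x₀ := (0 : ℝ)) (Metric.ball_mem_nhds (0 : ℝ) hε) ?_ ?_ ?_ ?_ ?_ ?_).2
  · refine hmain.congr_deriv ?_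
    refine MeasureTheory.setIntegral_congr_fun hK.measurableSet fun u hu => ?_
    exact (hd (0, u) (h0 u hu)).deriv.symm
  · filter_upwards [Metric.closedBall_mem_nhds (0 : ℝ) hε] with t ht
    exact (hslice t ht).aestronglyMeasurable_of_isCompact hK hK.measurableSet
  · exact (hslice 0 h0ball).integrableOn_compact hK
  · refine ContinuousOn.aestronglyMeasurable_of_isCompact ?_ hK hK.measurableSet
    exact hcont.comp (f := fun u => ((0 : ℝ), u)) (by fun_prop) fun u hu => h0 u hu
  · filter_upwards [MeasureTheory.ae_restrict_mem hK.measurableSet] with u hu t ht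
    exact hC (t, u) ⟨Metric.ball_subset_closedBall ht, hu⟩
  · have : Fact (μ K < ⊤) := ⟨hK.measure_lt_top⟩
    exact MeasureTheory.integrable_const _
  · filter_upwards [MeasureTheory.ae_restrict_mem hK.measurableSet] with u hu t ht
    exact hd (t, u) (hsub ⟨Metric.ball_subset_closedBall ht, hu⟩)

/-- The first variation of the volume at a Lagrangian immersion with non-degenerate induced
metric, before integration by parts. -/
theorem hasDerivAt_volume_of_lagrangian {n p : ℕ} {U K : Set (Fin n → ℝ)}
    {F : (Fin n → ℝ) → (Fin n → ℂ)}
    {δ : ℝ} {Φ : ℝ → (Fin n → ℝ) → (Fin n → ℂ)} (hU : IsOpen U)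
    (hlag : ∀ u ∈ U, ∀ i j, (herm p (jac F u i) (jac F u j)).im = 0)
    (hdet : ∀ u ∈ U, jacDet F u ≠ 0) (hδ : 0 < δ) (hK : IsCompact K) (hKU : K ⊆ U)
    (hΦ : ContDiffOn ℝ ∞ (fun q : ℝ × (Fin n → ℝ) => Φ q.1 q.2) (Set.Ioo (-δ) δ ×ˢ U))
    (hΦ0 : ∀ u ∈ U, Φ 0 u = F u) :
    HasDerivAt (fun t : ℝ => ∫ u in K, volumeDensity p (Φ t) u)
      (∫ u in K, ((starRingEnd ℂ) (jacDet F u) / (‖jacDet F u‖ : ℂ) *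
        ∑ i, ((jac F u).updateRow i
          (fderiv ℝ (fun u => deriv (fun t => Φ t u) 0) u (Pi.single i 1))).det).re) 0 := by
  set Ψ : ℝ × (Fin n → ℝ) → (Fin n → ℂ) := fun q => Φ q.1 q.2 with hΨ
  set O : Set (ℝ × (Fin n → ℝ)) := Set.Ioo (-δ) δ ×ˢ U with hO
  have hOo : IsOpen O := isOpen_Ioo.prod hU
  have h0mem : (0 : ℝ) ∈ Set.Ioo (-δ) δ := ⟨by linarith, hδ⟩
  have hΨd : ∀ q ∈ O, DifferentiableAt ℝ Ψ q := fun q hq =>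
    (hΦ.differentiableOn (by simp)).differentiableAt (hOo.mem_nhds hq)
  have hslice : ∀ t u, (t, u) ∈ O → ∀ w, fderiv ℝ (Φ t) u w = fderiv ℝ Ψ (t, u) (0, w) := by
    intro t u hq w
    have h2 : HasFDerivAt (fun u : Fin n → ℝ => (t, u))
        (ContinuousLinearMap.inr ℝ ℝ (Fin n → ℝ)) u := hasFDerivAt_prodMk_right t u
    have := HasFDerivAt.comp (f := fun u : Fin n → ℝ => (t, u)) u (hΨd (t, u) hq).hasFDerivAt h2
    have h3 : HasFDerivAt (Φ t) ((fderiv ℝ Ψ (t, u)).comp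
      (ContinuousLinearMap.inr ℝ ℝ (Fin n → ℝ))) u := this
    rw [h3.fderiv]
    simp
  have hslice' : ∀ t u, (t, u) ∈ O → deriv (fun s => Φ s u) t = fderiv ℝ Ψ (t, u) (1, 0) := by
    intro t u hq
    have h2 : HasDerivAt (fun t : ℝ => (t, u)) ((1 : ℝ), (0 : Fin n → ℝ)) t :=
      (hasDerivAt_id t).prodMk (hasDerivAt_const _ _)
    exact (HasFDerivAt.comp_hasDerivAt (f := fun t : ℝ => (t, u)) t
      (hΨd (t, u) hq).hasFDerivAt h2).deriv
  set E : ℝ × (Fin n → ℝ) → Matrix (Fin n) (Fin n) ℂ :=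
    fun q => Matrix.of fun i => fderiv ℝ Ψ q (0, Pi.single i 1) with hE
  have hEs : ∀ i k, ContDiffOn ℝ ∞ (fun q => E q i k) O := fun i k =>
    contDiffOn_pi.1 (contDiffOn_fderiv_apply hOo hΦ (0, Pi.single i 1)) k
  set N : ℝ × (Fin n → ℝ) → ℝ := fun q =>
    (Matrix.of fun i j => metric p (E q i) (E q j)).det with hN
  have hNs : ContDiffOn ℝ ∞ N O := by
    refine contDiffOn_det fun i j => ?_
    have : ContDiffOn ℝ ∞ (fun q => ∑ k, (sgn p k : ℂ) * (E q i k * (starRingEnd ℂ) (E q j k)))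
        O := by
      refine ContDiffOn.sum fun k _ => contDiffOn_const.mul ((hEs i k).mul ?_)
      exact Complex.conjCLE.contDiff.comp_contDiffOn (hEs j k)
    exact Complex.reCLM.contDiff.comp_contDiffOn this
  have hvd : ∀ t u, (t, u) ∈ O → volumeDensity p (Φ t) u = Real.sqrt |N (t, u)| := by
    intro t u hq
    simp only [volumeDensity, inducedMetric, hN, hE]
    congr 3
    ext i j
    simp only [Matrix.of_apply, hslice t u hq]
    rfl
  have hE0 : ∀ u ∈ U, E (0, u) = jac F u := by
    intro u hu
    have hev : Φ 0 =ᶠ[nhds u] F := by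
      filter_upwards [hU.mem_nhds hu] with y hy using hΦ0 y hy
    ext i k
    simp only [hE, jac, Matrix.of_apply]
    rw [← hslice 0 u ⟨h0mem, hu⟩, hev.fderiv_eq]
  have hN0 : ∀ u ∈ U, N (0, u) ≠ 0 := by
    intro u hu
    simp only [hN]
    rw [det_metric_gram p (by rw [hE0 u hu]; exact hlag u hu), hE0 u hu]
    refine mul_ne_zero ?_ (by simpa [jacDet] using hdet u hu)
    rcases prod_sgn_eq (n := n) p with h | h <;> rw [h] <;> norm_num
  set W : Set (ℝ × (Fin n → ℝ)) := O ∩ N ⁻¹' {0}ᶜ with hWdef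
  have hW : IsOpen W := hNs.continuousOn.isOpen_inter_preimage hOo isOpen_compl_singleton
  have hsm : ContDiffOn ℝ 1 (fun q : ℝ × (Fin n → ℝ) => Real.sqrt |N (q.1, q.2)|) W := by
    intro q hq
    have h1 : ContDiffAt ℝ 1 N q := (hNs.contDiffAt (hOo.mem_nhds hq.1)).of_le (by simp)
    have h2 : N q ≠ 0 := hq.2
    exact ((contDiffAt_abs h2).comp q h1).sqrt (abs_ne_zero.2 h2) |>.contDiffWithinAt
  have hmain := hasDerivAt_setIntegral_of_contDiffOn (μ := MeasureTheory.volume)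
    (v := fun t u => Real.sqrt |N (t, u)|) hW hK
    (fun u hu => ⟨⟨h0mem, hKU hu⟩, hN0 u (hKU hu)⟩) hsm
  have hev : (fun t : ℝ => ∫ u in K, volumeDensity p (Φ t) u) =ᶠ[nhds 0]
      fun t => ∫ u in K, Real.sqrt |N (t, u)| := by
    filter_upwards [isOpen_Ioo.mem_nhds h0mem] with t ht
    exact MeasureTheory.setIntegral_congr_fun hK.measurableSet fun u hu =>
      hvd t u ⟨ht, hKU hu⟩
  refine (hmain.congr_of_eventuallyEq hev).congr_deriv ?_
  refine MeasureTheory.setIntegral_congr_fun hK.measurableSet fun u hu => ?_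
  have hq : ((0 : ℝ), u) ∈ O := ⟨h0mem, hKU hu⟩
  have hX : ∀ w, fderiv ℝ (fun u => deriv (fun t => Φ t u) 0) u w =
      fderiv ℝ (fderiv ℝ Ψ) (0, u) (1, 0) (0, w) := by
    intro w
    have hev : (fun u => deriv (fun t => Φ t u) 0) =ᶠ[nhds u]
        fun y => fderiv ℝ Ψ (0, y) (1, 0) := by
      filter_upwards [hU.mem_nhds (hKU hu)] with y hy using hslice' 0 y ⟨h0mem, hy⟩
    have hd2 : HasFDerivAt (fderiv ℝ Ψ) (fderiv ℝ (fderiv ℝ Ψ) (0, u)) (0, u) :=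
      (((hΦ.fderiv_of_isOpen (m := ∞) hOo (by simp)).differentiableOn (by simp)).differentiableAt
        (hOo.mem_nhds hq)).hasFDerivAt
    have h2 : HasFDerivAt (fun u : Fin n → ℝ => ((0 : ℝ), u))
        (ContinuousLinearMap.inr ℝ ℝ (Fin n → ℝ)) u := hasFDerivAt_prodMk_right 0 u
    have h3 := (HasFDerivAt.comp (f := fun u : Fin n → ℝ => ((0 : ℝ), u)) u hd2 h2).clm_apply
      (hasFDerivAt_const ((1 : ℝ), (0 : Fin n → ℝ)) u)
    have h4 : HasFDerivAt (fun y : Fin n → ℝ => fderiv ℝ Ψ (0, y) (1, 0)) _ u := h3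
    rw [hev.fderiv_eq, h4.fderiv]
    have hsymm : IsSymmSndFDerivAt ℝ Ψ (0, u) :=
      (hΦ.contDiffAt (hOo.mem_nhds hq)).isSymmSndFDerivAt (by
        simp only [minSmoothness_of_isRCLikeNormedField]
        exact WithTop.coe_le_coe.2 (le_top : (2 : ℕ∞) ≤ ⊤))
    simp only [add_apply, ContinuousLinearMap.comp_apply,
      ContinuousLinearMap.flip_apply, ContinuousLinearMap.inr_apply,
      zero_apply, map_zero, zero_add]
    exact hsymm.eq _ _
  have hEd : ∀ i k, HasDerivAt (fun t => E (t, u) i k)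
      ((Matrix.of fun i => fderiv ℝ (fun u => deriv (fun t => Φ t u) 0) u (Pi.single i 1) :
        Matrix (Fin n) (Fin n) ℂ) i k) 0 := by
    intro i k
    have hd2 : HasFDerivAt (fderiv ℝ Ψ) (fderiv ℝ (fderiv ℝ Ψ) (0, u)) (0, u) :=
      (((hΦ.fderiv_of_isOpen (m := ∞) hOo (by simp)).differentiableOn (by simp)).differentiableAt
        (hOo.mem_nhds hq)).hasFDerivAt
    have h2 : HasDerivAt (fun t : ℝ => (t, u)) ((1 : ℝ), (0 : Fin n → ℝ)) 0 :=
      (hasDerivAt_id (0 : ℝ)).prodMk (hasDerivAt_const _ _)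
    have h3 := (HasFDerivAt.comp_hasDerivAt (f := fun t : ℝ => (t, u)) 0 hd2 h2).clm_apply
      (hasDerivAt_const (0 : ℝ) ((0 : ℝ), (Pi.single i 1 : Fin n → ℝ)))
    have h4 := hasDerivAt_pi.1 h3 k
    refine h4.congr_deriv ?_
    simp [hX]
  have := hasDerivAt_sqrt_abs_det_gram p hEd (by rw [hE0 u (hKU hu)]; exact hlag u (hKU hu))
    (by rw [hE0 u (hKU hu)]; exact hdet u (hKU hu))
  rw [hE0 u (hKU hu)] at this
  exact this.deriv

/-! ### Integration by parts -/

theorem integral_fderiv_apply_eq_zero {X : Type*} [NormedAddCommGroup X] [NormedSpace ℝ X]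
    [MeasurableSpace X] [BorelSpace X] [FiniteDimensional ℝ X] {μ : MeasureTheory.Measure X}
    [μ.IsAddHaarMeasure] {g : X → ℂ} (hg : ContDiff ℝ ∞ g) (hc : HasCompactSupport g) (v : X) :
    ∫ u, fderiv ℝ g u v ∂μ = 0 := by
  have hg' : Continuous fun u => fderiv ℝ g u v :=
    (hg.continuous_fderiv (by simp)).clm_apply continuous_const
  have hc' : HasCompactSupport fun u => fderiv ℝ g u v := hc.fderiv_apply ℝ v
  have := integral_mul_fderiv_eq_neg_fderiv_mul_of_integrable (μ := μ) (f := fun _ : X => (1 : ℂ))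
    (g := g) (v := v) (by simp) (by simpa using hg'.integrable_of_hasCompactSupport hc')
    (by simpa using hg.continuous.integrable_of_hasCompactSupport hc)
    (fun _ _ => differentiableAt_const _) (fun u _ => (hg.differentiable (by simp)) u)
  simpa using this

/-- If the vectors `S i j` are symmetric in `i` and `j`, the terms in which two distinct rows `i`,
`j` are replaced by `X` and `S i j` cancel in pairs. -/
theorem sum_det_updateRow_updateRow {n : ℕ} (A : Matrix (Fin n) (Fin n) ℂ) (X : Fin n → ℂ)
    (Y : Fin n → Fin n → ℂ) (S : Fin n → Fin n → Fin n → ℂ) (hS : ∀ i j, S i j = S j i) :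
    ∑ i, ∑ j, ((A.updateRow i X).updateRow j (if j = i then Y i else S i j)).det =
      ∑ i, (A.updateRow i (Y i)).det := by
  set a : Fin n → Fin n → ℂ := fun i j =>
    if j = i then 0 else ((A.updateRow i X).updateRow j (S i j)).det with ha
  have hanti : ∀ i j, a j i = -a i j := by
    intro i j
    simp only [ha]
    by_cases h : i = j
    · subst h; simp
    · rw [if_neg h, if_neg (Ne.symm h)]
      have := (Matrix.detRowAlternating (R := ℂ) (n := Fin n)).map_swap
        ((A.updateRow i X).updateRow j (S i j)) h
      change ((A.updateRow j X).updateRow i (S j i)).det = -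
        (Matrix.detRowAlternating ((A.updateRow i X).updateRow j (S i j)))
      rw [← this]
      change _ = Matrix.det _
      congr 1
      ext k l
      change _ = ((A.updateRow i X).updateRow j (S i j)) (Equiv.swap i j k) l
      simp only [Matrix.updateRow_apply]
      by_cases hki : k = i
      · subst hki
        simp [hS]
      · by_cases hkj : k = j
        · subst hkj
          simp [h, hki]
        · simp [Equiv.swap_apply_of_ne_of_ne hki hkj, hki, hkj]
  have hzero : ∑ i, ∑ j, a i j = 0 := by
    have h1 : ∑ i, ∑ j, a i j = -∑ i, ∑ j, a i j := by
      conv_lhs => rw [Finset.sum_comm]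
      simp_rw [← Finset.sum_neg_distrib]
      exact Finset.sum_congr rfl fun i _ => Finset.sum_congr rfl fun j _ => hanti i j
    exact self_eq_neg.1 h1
  have hsplit : ∀ i j, ((A.updateRow i X).updateRow j (if j = i then Y i else S i j)).det =
      a i j + if j = i then (A.updateRow i (Y i)).det else 0 := by
    intro i j
    simp only [ha]
    by_cases h : j = i
    · subst h; simp
    · simp [h]
  simp_rw [hsplit, Finset.sum_add_distrib, hzero, zero_add]
  simp

/-- The pointwise divergence formula behind the first variation: the cofactors of a Jacobian matrix
are divergence free (Piola's identity). -/
theorem sum_fderiv_mul_det_updateRow_jac {n : ℕ} {U : Set (Fin n → ℝ)}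
    {F X : (Fin n → ℝ) → (Fin n → ℂ)} {φ : (Fin n → ℝ) → ℂ} (hU : IsOpen U)
    (hF : ContDiffOn ℝ ∞ F U) (hX : ContDiffOn ℝ ∞ X U) (hφ : ContDiffOn ℝ ∞ φ U)
    {u : Fin n → ℝ} (hu : u ∈ U) :
    ∑ i, fderiv ℝ (fun y => φ y * ((jac F y).updateRow i (X y)).det) u (Pi.single i 1) =
      φ u * ∑ i, ((jac F u).updateRow i (fderiv ℝ X u (Pi.single i 1))).det +
      ∑ i, fderiv ℝ φ u (Pi.single i 1) * ((jac F u).updateRow i (X u)).det := by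
  have hdet : ∀ i, ContDiffOn ℝ ∞ (fun y => ((jac F y).updateRow i (X y)).det) U :=
    contDiffOn_det_updateRow_jac hU hF hX
  have hdiff : ∀ {Y : Type} [NormedAddCommGroup Y] [NormedSpace ℝ Y] {g : (Fin n → ℝ) → Y},
      ContDiffOn ℝ ∞ g U → DifferentiableAt ℝ g u := fun hg =>
    (hg.differentiableOn (by simp)).differentiableAt (hU.mem_nhds hu)
  have hcomp : ∀ {Y : Type} [NormedAddCommGroup Y] [NormedSpace ℝ Y] {g : (Fin n → ℝ) → Y}
      (i : Fin n), ContDiffOn ℝ ∞ g U → HasDerivAt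
        (fun t : ℝ => g (u + t • (Pi.single i 1 : Fin n → ℝ))) (fderiv ℝ g u (Pi.single i 1)) 0 :=
    fun i hg => hasDerivAt_line (hdiff hg) _
  set S : Fin n → Fin n → Fin n → ℂ := fun i j =>
    fderiv ℝ (fun y => fderiv ℝ F y (Pi.single j 1)) u (Pi.single i 1) with hSdef
  have hS : ∀ i j, S i j = S j i := by
    have hd2 : DifferentiableAt ℝ (fderiv ℝ F) u :=
      hdiff (hF.fderiv_of_isOpen (m := ∞) hU (by simp))
    have h2 : ∀ i j, S i j = fderiv ℝ (fderiv ℝ F) u (Pi.single i 1) (Pi.single j 1) := by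
      intro i j
      simp only [hSdef]
      rw [fderiv_clm_apply hd2 (differentiableAt_const _)]
      simp
    intro i j
    rw [h2, h2]
    have hsymm : IsSymmSndFDerivAt ℝ F u :=
      (hF.contDiffAt (hU.mem_nhds hu)).isSymmSndFDerivAt (by
        simp only [minSmoothness_of_isRCLikeNormedField]
        exact WithTop.coe_le_coe.2 (le_top : (2 : ℕ∞) ≤ ⊤))
    exact hsymm.eq _ _
  have hder : ∀ i, fderiv ℝ (fun y => ((jac F y).updateRow i (X y)).det) u (Pi.single i 1) =
      ∑ j, (((jac F u).updateRow i (X u)).updateRow j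
        (if j = i then fderiv ℝ X u (Pi.single i 1) else S i j)).det := by
    intro i
    have h1 := hcomp i (hdet i)
    have h2 : HasDerivAt
        (fun t : ℝ => ((jac F (u + t • (Pi.single i 1 : Fin n → ℝ))).updateRow i
          (X (u + t • (Pi.single i 1 : Fin n → ℝ)))).det) _ 0 :=
      hasDerivAt_det (A' := Matrix.of fun j =>
        if j = i then fderiv ℝ X u (Pi.single i 1) else S i j) (by
        intro j k
        simp only [Matrix.updateRow_apply, Matrix.of_apply]
        split_ifs with h
        · exact hasDerivAt_pi.1 (hcomp i hX) k
        · exact hasDerivAt_pi.1 (hcomp i (contDiffOn_fderiv_apply hU hF (Pi.single j 1))) k)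
    rw [h1.unique h2]
    simp
    rfl
  have hprod : ∀ i, fderiv ℝ (fun y => φ y * ((jac F y).updateRow i (X y)).det) u
      (Pi.single i 1) = φ u * fderiv ℝ (fun y => ((jac F y).updateRow i (X y)).det) u
        (Pi.single i 1) + fderiv ℝ φ u (Pi.single i 1) * ((jac F u).updateRow i (X u)).det := by
    intro i
    rw [fderiv_fun_mul (hdiff hφ) (hdiff (hdet i))]
    simp [mul_comm]
  simp_rw [hprod, Finset.sum_add_distrib, hder, ← Finset.mul_sum]
  rw [sum_det_updateRow_updateRow (jac F u) (X u) _ S hS]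

theorem setIntegral_mul_sum_det_updateRow_jac {n : ℕ} {U K : Set (Fin n → ℝ)}
    {F X : (Fin n → ℝ) → (Fin n → ℂ)} {φ : (Fin n → ℝ) → ℂ} (hU : IsOpen U)
    (hF : ContDiffOn ℝ ∞ F U) (hX : ContDiffOn ℝ ∞ X U) (hφ : ContDiffOn ℝ ∞ φ U)
    (hK : IsCompact K) (hKU : K ⊆ U) (hX0 : ∀ u ∈ U \ K, X u = 0) :
    ∫ u in K, φ u * ∑ i, ((jac F u).updateRow i (fderiv ℝ X u (Pi.single i 1))).det =
      -∫ u in K, ∑ i, fderiv ℝ φ u (Pi.single i 1) * ((jac F u).updateRow i (X u)).det := by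
  set V : Fin n → (Fin n → ℝ) → ℂ := fun i y => φ y * ((jac F y).updateRow i (X y)).det with hV
  have hVs : ∀ i, ContDiffOn ℝ ∞ (V i) U := fun i =>
    hφ.mul (contDiffOn_det_updateRow_jac hU hF hX i)
  have hV0 : ∀ i, ∀ u ∈ U \ K, V i u = 0 := by
    intro i u hu
    simp only [hV, hX0 u hu]
    rw [Matrix.det_eq_zero_of_row_eq_zero i (by simp), mul_zero]
  have hevU : ∀ i, ∀ u ∈ U, K.indicator (V i) =ᶠ[nhds u] V i := by
    intro i u hu
    filter_upwards [hU.mem_nhds hu] with y hy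
    by_cases hyK : y ∈ K
    · rw [Set.indicator_of_mem hyK]
    · rw [Set.indicator_of_notMem hyK, hV0 i y ⟨hy, hyK⟩]
  have hevK : ∀ i, ∀ u ∉ K, K.indicator (V i) =ᶠ[nhds u] fun _ => 0 := by
    intro i u hu
    filter_upwards [hK.isClosed.isOpen_compl.mem_nhds hu] with y hy
    rw [Set.indicator_of_notMem hy]
  have hsm : ∀ i, ContDiff ℝ ∞ (K.indicator (V i)) := by
    intro i
    refine contDiff_iff_contDiffAt.2 fun u => ?_
    by_cases hu : u ∈ K
    · exact ((hVs i).contDiffAt (hU.mem_nhds (hKU hu))).congr_of_eventuallyEq (hevU i u (hKU hu))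
    · exact contDiffAt_const.congr_of_eventuallyEq (hevK i u hu)
  have hcs : ∀ i, HasCompactSupport (K.indicator (V i)) := fun i =>
    HasCompactSupport.intro hK fun u hu => Set.indicator_of_notMem hu _
  have hint : ∀ i, ∫ u in K, fderiv ℝ (V i) u (Pi.single i 1) = 0 := by
    intro i
    have hoff : ∀ u, u ∉ K → fderiv ℝ (K.indicator (V i)) u (Pi.single i 1) = 0 := by
      intro u hu
      rw [(hevK i u hu).fderiv_eq]
      simp
    have h0 := integral_fderiv_apply_eq_zero (μ := MeasureTheory.volume) (hsm i) (hcs i)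
      (Pi.single i 1)
    rw [← MeasureTheory.setIntegral_eq_integral_of_forall_compl_eq_zero hoff] at h0
    rw [← h0]
    refine MeasureTheory.setIntegral_congr_fun hK.measurableSet fun u hu => ?_
    exact congrArg (fun L : (Fin n → ℝ) →L[ℝ] ℂ => L (Pi.single i 1))
      (hevU i u (hKU hu)).fderiv_eq.symm
  have hcontV : ∀ i, MeasureTheory.IntegrableOn (fun u => fderiv ℝ (V i) u (Pi.single i 1)) K :=
    fun i => ((contDiffOn_fderiv_apply hU (hVs i) _).continuousOn.mono hKU).integrableOn_compact hK
  have hpoint : ∀ u ∈ U, φ u * ∑ i, ((jac F u).updateRow i (fderiv ℝ X u (Pi.single i 1))).det =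
      (∑ i, fderiv ℝ (V i) u (Pi.single i 1)) -
        ∑ i, fderiv ℝ φ u (Pi.single i 1) * ((jac F u).updateRow i (X u)).det := by
    intro u hu
    rw [hV, sum_fderiv_mul_det_updateRow_jac hU hF hX hφ hu]
    ring
  have hsmooth2 : ContDiffOn ℝ ∞
      (fun u => ∑ i, fderiv ℝ φ u (Pi.single i 1) * ((jac F u).updateRow i (X u)).det) U := by
    exact ContDiffOn.sum fun i _ => (contDiffOn_fderiv_apply hU hφ _).mul
      (contDiffOn_det_updateRow_jac hU hF hX i)
  rw [MeasureTheory.setIntegral_congr_fun hK.measurableSet fun u hu => hpoint u (hKU hu),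
    MeasureTheory.integral_sub (MeasureTheory.integrable_finsetSum _ fun i _ => hcontV i)
      ((hsmooth2.continuousOn.mono hKU).integrableOn_compact hK),
    MeasureTheory.integral_finsetSum _ fun i _ => hcontV i]
  simp [hint]

/-! ### Critical points of the volume among Lagrangian immersions -/

theorem hasDerivAt_conj_div_norm {d : ℝ → ℂ} {d' : ℂ} {t : ℝ} (h : HasDerivAt d d' t)
    (h0 : d t ≠ 0) :
    HasDerivAt (fun s => (starRingEnd ℂ) (d s) / (‖d s‖ : ℂ))
      (-Complex.I * (((starRingEnd ℂ) (d t) * d').im : ℂ) / ((‖d t‖ : ℂ) * d t)) t := by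
  have hn : ‖d t‖ ≠ 0 := norm_ne_zero_iff.2 h0
  have hsq : HasDerivAt (fun s => Complex.normSq (d s))
      (2 * ((starRingEnd ℂ) (d t) * d').re) t := by
    have h1 : HasDerivAt (fun s => (starRingEnd ℂ) (d s) * d s)
      ((starRingEnd ℂ) d' * d t + (starRingEnd ℂ) (d t) * d') t := h.star.mul h
    have h2 := hasDerivAt_re h1
    simp only [← Complex.normSq_eq_conj_mul_self, Complex.ofReal_re] at h2
    refine h2.congr_deriv ?_
    simp only [Complex.add_re, Complex.mul_re, Complex.conj_re, Complex.conj_im]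
    ring
  have hnorm : HasDerivAt (fun s => ‖d s‖) (((starRingEnd ℂ) (d t) * d').re / ‖d t‖) t := by
    have := hsq.sqrt (by simpa using h0)
    refine this.congr_deriv ?_
    change _ / (2 * ‖d t‖) = _
    field_simp
  have hc : (‖d t‖ : ℂ) ≠ 0 := by exact_mod_cast hn
  have hdiv := h.star.div hnorm.ofReal_comp hc
  refine hdiv.congr_deriv ?_
  have e1 : (‖d t‖ : ℂ) ^ 2 = (starRingEnd ℂ) (d t) * d t := by
    rw [← Complex.normSq_eq_conj_mul_self, Complex.normSq_eq_norm_sq]; push_cast; rfl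
  have e2 : (starRingEnd ℂ) d' * d t = (((starRingEnd ℂ) (d t) * d').re : ℂ) -
      Complex.I * (((starRingEnd ℂ) (d t) * d').im : ℂ) := by
    apply Complex.ext <;> simp <;> ring
  simp only [RCLike.star_def]
  rw [div_eq_div_iff (pow_ne_zero 2 hc) (mul_ne_zero hc h0)]
  push_cast
  field_simp
  linear_combination (‖d t‖ : ℂ) ^ 2 * e2 + (((starRingEnd ℂ) (d t) * d').re : ℂ) * e1

theorem contDiffOn_conj_div_norm {X : Type*} [NormedAddCommGroup X] [NormedSpace ℝ X] {d : X → ℂ}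
    {U : Set X} (hd : ContDiffOn ℝ ∞ d U) (h0 : ∀ u ∈ U, d u ≠ 0) :
    ContDiffOn ℝ ∞ (fun y => (starRingEnd ℂ) (d y) / (‖d y‖ : ℂ)) U := by
  simp only [div_eq_mul_inv]
  refine (Complex.conjCLE.contDiff.comp_contDiffOn hd).mul
    ((Complex.ofRealCLM.contDiff.comp_contDiffOn (hd.norm ℝ h0)).inv fun u hu => ?_)
  simpa using h0 u hu

/-- The first variation of the volume at a Lagrangian immersion with non-degenerate induced
metric: only the derivative of the phase `conj D / |D|` of the complex Jacobian determinant `D`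
enters. -/
theorem hasDerivAt_volume {n p : ℕ} {U K : Set (Fin n → ℝ)} {F : (Fin n → ℝ) → (Fin n → ℂ)}
    {δ : ℝ} {Φ : ℝ → (Fin n → ℝ) → (Fin n → ℂ)} (hU : IsOpen U) (hF : ContDiffOn ℝ ∞ F U)
    (hlag : ∀ u ∈ U, ∀ i j, (herm p (jac F u i) (jac F u j)).im = 0)
    (hdet : ∀ u ∈ U, jacDet F u ≠ 0) (hδ : 0 < δ) (hK : IsCompact K) (hKU : K ⊆ U)
    (hΦ : ContDiffOn ℝ ∞ (fun q : ℝ × (Fin n → ℝ) => Φ q.1 q.2) (Set.Ioo (-δ) δ ×ˢ U))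
    (hΦ0 : ∀ u ∈ U, Φ 0 u = F u)
    (hΦK : ∀ t ∈ Set.Ioo (-δ) δ, ∀ u ∈ U \ K, Φ t u = F u) :
    HasDerivAt (fun t : ℝ => ∫ u in K, volumeDensity p (Φ t) u)
      (-∫ u in K, (∑ i, fderiv ℝ
        (fun y => (starRingEnd ℂ) (jacDet F y) / (‖jacDet F y‖ : ℂ)) u (Pi.single i 1) *
        ((jac F u).updateRow i (deriv (fun t => Φ t u) 0)).det).re) 0 := by
  refine (hasDerivAt_volume_of_lagrangian hU hlag hdet hδ hK hKU hΦ hΦ0).congr_deriv ?_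
  have hD := contDiffOn_jacDet hU hF
  have h0mem : (0 : ℝ) ∈ Set.Ioo (-δ) δ := ⟨by linarith, hδ⟩
  set φ : (Fin n → ℝ) → ℂ := fun y => (starRingEnd ℂ) (jacDet F y) / (‖jacDet F y‖ : ℂ) with hφd
  set X : (Fin n → ℝ) → (Fin n → ℂ) := fun u => deriv (fun t => Φ t u) 0 with hXd
  have hφ : ContDiffOn ℝ ∞ φ U := contDiffOn_conj_div_norm hD hdet
  have hO : IsOpen (Set.Ioo (-δ) δ ×ˢ U) := isOpen_Ioo.prod hU
  have hX : ContDiffOn ℝ ∞ X U := by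
    have h1 := contDiffOn_fderiv_apply hO hΦ ((1 : ℝ), (0 : Fin n → ℝ))
    have h2 := h1.comp (f := fun u : Fin n → ℝ => ((0 : ℝ), u)) (s := U)
      (contDiff_prodMk_right 0).contDiffOn (fun u hu => ⟨h0mem, hu⟩)
    refine h2.congr fun u hu => ?_
    have h3 : HasDerivAt (fun t : ℝ => (t, u)) ((1 : ℝ), (0 : Fin n → ℝ)) 0 :=
      (hasDerivAt_id (0 : ℝ)).prodMk (hasDerivAt_const _ _)
    exact (HasFDerivAt.comp_hasDerivAt (f := fun t : ℝ => (t, u)) 0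
      ((hΦ.differentiableOn (by simp)).differentiableAt
        (hO.mem_nhds ⟨h0mem, hu⟩)).hasFDerivAt h3).deriv
  have hX0 : ∀ u ∈ U \ K, X u = 0 := by
    intro u hu
    have : (fun t => Φ t u) =ᶠ[nhds 0] fun _ => F u := by
      filter_upwards [isOpen_Ioo.mem_nhds h0mem] with t ht using hΦK t ht u hu
    simp only [hXd, this.deriv_eq, deriv_const]
  have hre : ∀ g : (Fin n → ℝ) → ℂ, ContDiffOn ℝ ∞ g U →
      ∫ u in K, (g u).re = (∫ u in K, g u).re := fun g hg =>
    integral_re (𝕜 := ℂ) ((hg.continuousOn.mono hKU).integrableOn_compact hK)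
  rw [hre _ (hφ.mul (ContDiffOn.sum fun i _ => contDiffOn_det_updateRow_jac hU hF
      (contDiffOn_fderiv_apply hU hX _) i)),
    hre _ (ContDiffOn.sum fun i _ => (contDiffOn_fderiv_apply hU hφ _).mul
      (contDiffOn_det_updateRow_jac hU hF hX i)),
    setIntegral_mul_sum_det_updateRow_jac hU hF hX hφ hK hKU hX0, Complex.neg_re]

/-- A Lagrangian immersion with non-degenerate induced metric is a critical point of the volume if
and only if its Lagrangian angle, the argument of the complex Jacobian determinant, is locally
constant. -/
theorem isVolumeCritical_iff {n p : ℕ} {U : Set (Fin n → ℝ)} {F : (Fin n → ℝ) → (Fin n → ℂ)}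
    (hU : IsOpen U) (hF : ContDiffOn ℝ ∞ F U)
    (hlag : ∀ u ∈ U, ∀ i j, (herm p (jac F u i) (jac F u j)).im = 0)
    (hdet : ∀ u ∈ U, jacDet F u ≠ 0) :
    IsVolumeCritical p U F ↔
      ∀ u ∈ U, ∀ v, ((starRingEnd ℂ) (jacDet F u) * fderiv ℝ (jacDet F) u v).im = 0 := by
  have hD := contDiffOn_jacDet hU hF
  set φ : (Fin n → ℝ) → ℂ := fun y => (starRingEnd ℂ) (jacDet F y) / (‖jacDet F y‖ : ℂ) with hφd
  have hφ : ContDiffOn ℝ ∞ φ U := contDiffOn_conj_div_norm hD hdet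
  have hφ' : ∀ u ∈ U, ∀ v, fderiv ℝ φ u v =
      -Complex.I * (((starRingEnd ℂ) (jacDet F u) * fderiv ℝ (jacDet F) u v).im : ℂ) /
        ((‖jacDet F u‖ : ℂ) * jacDet F u) := by
    intro u hu v
    have hcomp : ∀ {g : (Fin n → ℝ) → ℂ}, ContDiffOn ℝ ∞ g U → HasDerivAt
        (fun t : ℝ => g (u + t • v)) (fderiv ℝ g u v) 0 := fun hg =>
      hasDerivAt_line ((hg.differentiableOn (by simp)).differentiableAt (hU.mem_nhds hu)) v
    have h1 := hasDerivAt_conj_div_norm (hcomp hD) (by simpa using hdet u hu)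
    rw [(hcomp hφ).unique h1]
    simp
  constructor
  · intro hcrit u hu v
    have key : ∀ w : Fin n → ℂ, ∀ u ∈ U,
        (∑ i, fderiv ℝ φ u (Pi.single i 1) * ((jac F u).updateRow i w).det).re = 0 := by
      intro w
      set h : (Fin n → ℝ) → ℝ := fun u =>
        (∑ i, fderiv ℝ φ u (Pi.single i 1) * ((jac F u).updateRow i w).det).re with hh
      have hcont : ContinuousOn h U := by
        refine Complex.continuous_re.comp_continuousOn ?_
        refine ContDiffOn.continuousOn (𝕜 := ℝ) (n := ∞) ?_
        exact ContDiffOn.sum fun i _ => (contDiffOn_fderiv_apply hU hφ _).mul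
          (contDiffOn_det_updateRow_jac hU hF contDiffOn_const i)
      have hae := hU.ae_eq_zero_of_integral_contDiff_smul_eq_zero (μ := MeasureTheory.volume)
        (f := h) (hcont.locallyIntegrableOn hU.measurableSet) (by
          intro g hg hgc hgU
          set Φ : ℝ → (Fin n → ℝ) → (Fin n → ℂ) := fun t u => F u + (t * g u) • w with hΦd
          have hΦs : ContDiffOn ℝ ∞ (fun q : ℝ × (Fin n → ℝ) => Φ q.1 q.2)
              (Set.Ioo (-1) 1 ×ˢ U) := by
            refine (hF.comp contDiff_snd.contDiffOn fun q hq => hq.2).add ?_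
            exact ((contDiff_fst.mul (hg.comp contDiff_snd)).smul contDiff_const).contDiffOn
          have hΦ0 : ∀ u ∈ U, Φ 0 u = F u := fun u _ => by simp [hΦd]
          have hΦK : ∀ t ∈ Set.Ioo (-1 : ℝ) 1, ∀ u ∈ U \ tsupport g, Φ t u = F u := by
            intro t _ u hu
            simp [hΦd, image_eq_zero_of_notMem_tsupport hu.2]
          have h1 := hcrit 1 (tsupport g) Φ one_pos hgc hgU hΦs hΦ0 hΦK
          have h2 := hasDerivAt_volume hU hF hlag hdet one_pos hgc hgU hΦs hΦ0 hΦK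
          have h3 := h2.unique h1
          rw [neg_eq_zero] at h3
          rw [← h3, ← MeasureTheory.setIntegral_eq_integral_of_forall_compl_eq_zero
            (s := tsupport g) (fun u hu => by
              rw [image_eq_zero_of_notMem_tsupport hu, zero_smul])]
          refine MeasureTheory.setIntegral_congr_fun hgc.measurableSet fun u hu => ?_
          have hder : deriv (fun t => Φ t u) 0 = (g u : ℂ) • w := by
            have : HasDerivAt (fun t : ℝ => F u + (t * g u) • w) ((1 * g u) • w) 0 :=
              (((hasDerivAt_id (0 : ℝ)).mul_const (g u)).smul_const w).const_add (F u)
            rw [this.deriv, one_mul]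
            ext k; simp
          simp only [hder, Matrix.det_updateRow_smul, hh]
          rw [smul_eq_mul, ← Complex.re_ofReal_mul, Finset.mul_sum]
          congr 1
          refine Finset.sum_congr rfl fun i _ => ?_
          ring)
      have : h =ᵐ[MeasureTheory.volume.restrict U] fun _ => 0 := by
        filter_upwards [(MeasureTheory.ae_restrict_iff' hU.measurableSet).2 hae] with u hu using hu
      exact MeasureTheory.Measure.eqOn_open_of_ae_eq this hU hcont continuousOn_const
    have key2 : ∀ w : Fin n → ℂ,
        ∑ i, fderiv ℝ φ u (Pi.single i 1) * ((jac F u).updateRow i w).det = 0 := by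
      intro w
      apply Complex.ext
      · exact key w u hu
      · have := key (-Complex.I • w) u hu
        have hI : ∀ a b : ℂ, a * (-Complex.I * b) = -Complex.I * (a * b) := fun a b => by ring
        simp only [Matrix.det_updateRow_smul, hI, ← Finset.mul_sum] at this
        simpa using this
    have hzero : ∀ j, fderiv ℝ φ u (Pi.single j 1) = 0 := by
      intro j
      have := key2 (jac F u j)
      rw [Finset.sum_eq_single j] at this
      · rw [Matrix.updateRow_eq_self] at this
        exact (mul_eq_zero.1 this).resolve_right (hdet u hu)
      · intro i _ hij
        rw [Matrix.det_zero_of_row_eq (i := i) (j := j) hij (by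
          ext k; simp [Matrix.updateRow_apply, hij.symm]), mul_zero]
      · simp
    have hz : fderiv ℝ φ u = 0 := by
      ext1 v
      simp [clm_apply_eq_sum_single (fderiv ℝ φ u) v, hzero]
    have := hφ' u hu v
    rw [hz] at this
    have h0 := hdet u hu
    simpa [h0, Complex.ext_iff] using this.symm
  · intro h δ K Φ hδ hK hKU hΦ hΦ0 hΦK
    refine (hasDerivAt_volume hU hF hlag hdet hδ hK hKU hΦ hΦ0 hΦK).congr_deriv ?_
    rw [neg_eq_zero]
    refine MeasureTheory.setIntegral_eq_zero_of_forall_eq_zero fun u hu => ?_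
    have : ∀ v, fderiv ℝ φ u v = 0 := fun v => by
      rw [hφ' u (hKU hu), h u (hKU hu)]; simp
    simp only [hφd] at this
    simp [this]

/-! ### The forms and the matrix exponential -/

section Forms

variable {n : ℕ} (p : ℕ)

theorem realForm_comm (x y : Fin n → ℝ) : realForm p x y = realForm p y x :=
  Finset.sum_congr rfl fun j _ => by ring

theorem realForm_add_left (x y z : Fin n → ℝ) :
    realForm p (x + y) z = realForm p x z + realForm p y z := by
  simp only [realForm, ← Finset.sum_add_distrib]
  exact Finset.sum_congr rfl fun j _ => by simp only [Pi.add_apply]; ring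

theorem realForm_smul_left (a : ℝ) (x z : Fin n → ℝ) :
    realForm p (a • x) z = a * realForm p x z := by
  simp only [realForm, Finset.mul_sum]
  exact Finset.sum_congr rfl fun j _ => by simp only [Pi.smul_apply, smul_eq_mul]; ring

theorem realForm_add_right (x y z : Fin n → ℝ) :
    realForm p x (y + z) = realForm p x y + realForm p x z := by
  rw [realForm_comm, realForm_add_left, realForm_comm p y, realForm_comm p z]

theorem realForm_smul_right (a : ℝ) (x z : Fin n → ℝ) :
    realForm p x (a • z) = a * realForm p x z := by
  rw [realForm_comm, realForm_smul_left, realForm_comm]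

theorem realForm_zero_left (z : Fin n → ℝ) : realForm p 0 z = 0 := by simp [realForm]

theorem sgn_ne_zero (j : Fin n) : sgn p j ≠ 0 := fun h => by simpa [h] using sgn_mul_self p j

theorem realForm_single_right (x : Fin n → ℝ) (j : Fin n) :
    realForm p x (Pi.single j 1) = sgn p j * x j := by
  rw [realForm, Finset.sum_eq_single j (by intro b _ hb; simp [hb]) (by simp)]
  simp

theorem eq_zero_of_realForm_eq_zero {x : Fin n → ℝ} (h : ∀ y, realForm p x y = 0) : x = 0 := by
  ext j
  have := h (Pi.single j 1)
  rw [realForm_single_right] at this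
  exact (mul_eq_zero.1 this).resolve_left (sgn_ne_zero p j)

theorem herm_smul_smul (a : ℝ) (z w : Fin n → ℂ) :
    herm p ((a : ℂ) • z) ((a : ℂ) • w) = (a : ℂ) ^ 2 * herm p z w := by
  simp only [herm, Finset.mul_sum]
  refine Finset.sum_congr rfl fun j _ => ?_
  simp only [Pi.smul_apply, smul_eq_mul, map_mul, Complex.conj_ofReal]
  ring

/-- The vector `a + i b` of `ℂⁿ` with real part `a` and imaginary part `b`. -/
noncomputable def toComplex (a b : Fin n → ℝ) : Fin n → ℂ :=
  fun j => (a j : ℂ) + Complex.I * (b j : ℂ)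

theorem herm_toComplex (a b c d : Fin n → ℝ) :
    (herm p (toComplex a b) (toComplex c d)).im = realForm p b c - realForm p a d := by
  simp only [herm, toComplex, realForm, Complex.im_sum, ← Finset.sum_sub_distrib]
  refine Finset.sum_congr rfl fun j _ => ?_
  simp
  ring

/-- The diagonal matrix of the signs. -/
noncomputable def sgnMatrix (n p : ℕ) : Matrix (Fin n) (Fin n) ℂ :=
  Matrix.diagonal fun j => (sgn p j : ℂ)

theorem sgnMatrix_mul_self : sgnMatrix n p * sgnMatrix n p = 1 := by
  rw [sgnMatrix, Matrix.diagonal_mul_diagonal, ← Matrix.diagonal_one]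
  congr 1
  ext j
  exact_mod_cast sgn_mul_self p j

theorem herm_eq_dotProduct (z w : Fin n → ℂ) : herm p z w = star w ⬝ᵥ (sgnMatrix n p *ᵥ z) := by
  simp only [herm, dotProduct, sgnMatrix, Matrix.mulVec_diagonal]
  refine Finset.sum_congr rfl fun j _ => ?_
  simp only [Pi.star_apply, RCLike.star_def]
  ring

end Forms

section Exponential

variable {n : ℕ}

/-- The one-parameter group `s ↦ e^{iMs}`. -/
noncomputable def expI (M : Matrix (Fin n) (Fin n) ℝ) (s : ℝ) : Matrix (Fin n) (Fin n) ℂ :=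
  NormedSpace.exp ((Complex.I * (s : ℂ)) • M.map (fun a : ℝ => (a : ℂ)))

open scoped Matrix.Norms.Operator in
theorem hasDerivAt_expI (M : Matrix (Fin n) (Fin n) ℝ) (s : ℝ) (i j : Fin n) :
    HasDerivAt (fun s => expI M s i j)
      ((expI M s * (Complex.I • M.map (fun a : ℝ => (a : ℂ)))) i j) s := by
  have h := hasDerivAt_exp_smul_const (𝕂 := ℝ) (Complex.I • M.map (fun a : ℝ => (a : ℂ))) s
  have e : ∀ s : ℝ, s • (Complex.I • M.map (fun a : ℝ => (a : ℂ))) =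
      (Complex.I * (s : ℂ)) • M.map (fun a : ℝ => (a : ℂ)) := by
    intro s
    ext i j
    simp
    ring
  simp only [e] at h
  have h2 : HasDerivAt (fun s => (expI M s : Fin n → Fin n → ℂ))
    (expI M s * (Complex.I • M.map (fun a : ℝ => (a : ℂ))) : Matrix (Fin n) (Fin n) ℂ) s := h
  exact hasDerivAt_pi.1 (hasDerivAt_pi.1 h2 i) j

theorem contDiff_expI (M : Matrix (Fin n) (Fin n) ℝ) (i j : Fin n) :
    ContDiff ℝ ∞ (fun s => expI M s i j) := by
  have hder : ∀ i j, deriv (fun s => expI M s i j) = fun s =>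
      ∑ k, expI M s i k * (Complex.I • M.map (fun a : ℝ => (a : ℂ))) k j := by
    intro i j
    ext s
    exact (hasDerivAt_expI M s i j).deriv
  have key : ∀ m : ℕ, ∀ i j, ContDiff ℝ m (fun s => expI M s i j) := by
    intro m
    induction m with
    | zero =>
      intro i j
      exact contDiff_zero.2 (continuous_iff_continuousAt.2 fun s =>
        (hasDerivAt_expI M s i j).continuousAt)
    | succ m ih =>
      intro i j
      refine (contDiff_succ_iff_deriv (n := (m : WithTop ℕ∞))).2
        ⟨fun s => (hasDerivAt_expI M s i j).differentiableAt, by simp, ?_⟩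
      rw [hder]
      exact ContDiff.sum fun k _ => (ih i k).mul contDiff_const
  exact contDiff_infty.2 fun m => key m i j

theorem isUnit_expI (M : Matrix (Fin n) (Fin n) ℝ) (s : ℝ) : IsUnit (expI M s) :=
  Matrix.isUnit_exp _

theorem herm_expI {p : ℕ} {M : Matrix (Fin n) (Fin n) ℝ}
    (hsa : ∀ x y : Fin n → ℝ, realForm p (M *ᵥ x) y = realForm p x (M *ᵥ y)) (s : ℝ)
    (z w : Fin n → ℂ) : herm p (expI M s *ᵥ z) (expI M s *ᵥ w) = herm p z w := by
  set Mc := M.map (fun a : ℝ => (a : ℂ)) with hMc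
  have hM : sgnMatrix n p * Mc * sgnMatrix n p = Mcᴴ := by
    ext i j
    have h1 := hsa (Pi.single i 1) (Pi.single j 1)
    rw [realForm_single_right, realForm_comm, realForm_single_right] at h1
    simp only [sgnMatrix, Matrix.mul_diagonal, Matrix.diagonal_mul, Matrix.conjTranspose_apply,
      hMc, Matrix.map_apply, RCLike.star_def, Complex.conj_ofReal]
    simp only [Matrix.mulVec_single_one, Matrix.col_apply] at h1
    have h2 := sgn_mul_self p j
    have : sgn p i * M i j * sgn p j = M j i := by rw [← h1]; linear_combination M j i * h2
    exact_mod_cast this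
  have hunit : IsUnit (sgnMatrix n p) :=
    ⟨⟨_, _, sgnMatrix_mul_self p, sgnMatrix_mul_self p⟩, rfl⟩
  have hinv : (sgnMatrix n p)⁻¹ = sgnMatrix n p := Matrix.inv_eq_right_inv (sgnMatrix_mul_self p)
  have hstar : (expI M s)ᴴ = sgnMatrix n p * (expI M s)⁻¹ * sgnMatrix n p := by
    have h1 : ((Complex.I * (s : ℂ)) • Mc)ᴴ =
        sgnMatrix n p * (-((Complex.I * (s : ℂ)) • Mc)) * (sgnMatrix n p)⁻¹ := by
      rw [hinv, Matrix.conjTranspose_smul, ← hM]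
      simp
    rw [expI, ← Matrix.exp_conjTranspose, h1, Matrix.exp_conj _ _ hunit, Matrix.exp_neg, hinv]
  have hprod : (expI M s)ᴴ * sgnMatrix n p * expI M s = sgnMatrix n p := by
    rw [hstar, Matrix.mul_assoc (sgnMatrix n p * (expI M s)⁻¹), sgnMatrix_mul_self, mul_one,
      Matrix.mul_assoc, Matrix.nonsing_inv_mul _ ((Matrix.isUnit_iff_isUnit_det _).1
        (isUnit_expI M s)), mul_one]
  rw [herm_eq_dotProduct, herm_eq_dotProduct, Matrix.star_mulVec, ← Matrix.dotProduct_mulVec,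
    Matrix.mulVec_mulVec, Matrix.mulVec_mulVec, hprod]

/-- Jacobi's formula for the determinant of `e^{iMs}`. -/
theorem hasDerivAt_det_expI (M : Matrix (Fin n) (Fin n) ℝ) (s : ℝ) :
    HasDerivAt (fun s => (expI M s).det) (Complex.I * (M.trace : ℂ) * (expI M s).det) s := by
  set B := Complex.I • M.map (fun a : ℝ => (a : ℂ)) with hB
  have h0 : HasDerivAt (fun t : ℝ => (1 + t • B : Matrix (Fin n) (Fin n) ℂ).det)
      (∑ i, ((1 : Matrix (Fin n) (Fin n) ℂ).updateRow i (B i)).det) 0 := by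
    have := hasDerivAt_det (A := fun t : ℝ => (1 + t • B : Matrix (Fin n) (Fin n) ℂ)) (A' := B)
      (t := 0) (fun i j => by
        have := (((hasDerivAt_id (0 : ℝ)).smul_const (B i j)).const_add
          ((1 : Matrix (Fin n) (Fin n) ℂ) i j))
        simpa using this)
    simpa using this
  have h1 := hasDerivAt_det (hasDerivAt_expI M s)
  refine h1.congr_deriv ?_
  -- The derivative of `det(e^{iMs} (1 + t B))` at `t = 0` is computed twice: by rows, and by
  -- multiplicativity of the determinant.
  have hdet : ∀ t : ℝ, ((expI M s) * (1 + t • B)).det = (expI M s).det * (1 + t • B).det :=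
    fun t => Matrix.det_mul _ _
  have h2 : HasDerivAt (fun t : ℝ => ((expI M s) * (1 + t • B)).det)
      (∑ i, ((expI M s).updateRow i ((expI M s * B) i)).det) 0 := by
    have := hasDerivAt_det (A := fun t : ℝ => (expI M s) * (1 + t • B))
      (A' := expI M s * B) (t := 0) (fun i j => by
        have := (((hasDerivAt_id (0 : ℝ)).smul_const ((expI M s * B) i j)).const_add
          (expI M s i j))
        simpa [mul_add] using this)
    simpa using this
  simp only [hdet] at h2
  have h3 := h2.unique (h0.const_mul _)
  rw [h3]
  have htr : ∀ i, ((1 : Matrix (Fin n) (Fin n) ℂ).updateRow i (B i)).det = B i i := by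
    intro i
    have := Matrix.cramer_transpose_apply (1 : Matrix (Fin n) (Fin n) ℂ) (B i) i
    rw [← this]
    simp
  simp_rw [htr]
  simp only [hB, Matrix.smul_apply, Matrix.map_apply, smul_eq_mul, ← Finset.mul_sum,
    Matrix.trace, Matrix.diag_apply]
  push_cast
  ring

end Exponential

/-! ### The evolving map in a local parametrization -/

/-- Replacing `m` by `z` in the rows `b i + τ i m`, where the functional `w` vanishes at the `b i`
and is `1` at `m`, multiplies the determinant by the value of `w` at `z`: this is the determinant of
the linear map which fixes the kernel of `w` and maps `m` to `z`. -/
theorem det_of_add_smul {n : ℕ} {b : Fin n → Fin n → ℂ} {τ m w : Fin n → ℂ}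
    (hb : ∀ i, b i ⬝ᵥ w = 0) (hm : m ⬝ᵥ w = 1) (z : Fin n → ℂ) :
    (Matrix.of fun i => b i + τ i • z).det = (Matrix.of fun i => b i + τ i • m).det * (z ⬝ᵥ w) := by
  have hprod : (Matrix.of fun i => b i + τ i • z) = (Matrix.of fun i => b i + τ i • m) *
      (1 + Matrix.replicateCol Unit w * Matrix.replicateRow Unit (z - m)) := by
    ext i j
    rw [mul_add, mul_one, ← Matrix.mul_assoc, Matrix.add_apply, Matrix.mul_apply]
    simp only [Finset.univ_unique, Finset.sum_singleton, Matrix.replicateRow_apply]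
    have h1 : ((Matrix.of fun i => b i + τ i • m) * Matrix.replicateCol Unit w) i default =
        τ i := by
      change (b i + τ i • m) ⬝ᵥ w = τ i
      rw [add_dotProduct, hb, smul_dotProduct, hm, zero_add, smul_eq_mul, mul_one]
    rw [h1]
    simp only [Matrix.of_apply, Pi.add_apply, Pi.smul_apply, Pi.sub_apply, smul_eq_mul]
    ring
  rw [hprod, Matrix.det_mul, Matrix.det_one_add_replicateCol_mul_replicateRow, sub_dotProduct, hm]
  ring

theorem toComplex_dotProduct {n : ℕ} (p : ℕ) (a b m : Fin n → ℝ) (e : ℝ) :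
    toComplex a b ⬝ᵥ (fun k => ((sgn p k * m k / e : ℝ) : ℂ)) =
      ((realForm p a m / e : ℝ) : ℂ) + Complex.I * ((realForm p b m / e : ℝ) : ℂ) := by
  simp only [realForm, dotProduct, Finset.sum_div, Complex.ofReal_sum, Finset.mul_sum,
    ← Finset.sum_add_distrib]
  refine Finset.sum_congr rfl fun k _ => ?_
  simp only [toComplex]
  push_cast
  ring

theorem toComplex_zero_dotProduct {n : ℕ} (p : ℕ) (a m : Fin n → ℝ) (e : ℝ) :
    toComplex a 0 ⬝ᵥ (fun k => ((sgn p k * m k / e : ℝ) : ℂ)) = ((realForm p a m / e : ℝ) : ℂ) := by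
  rw [toComplex_dotProduct, realForm_zero_left]
  simp

theorem det_add_smul_toComplex {n : ℕ} (p : ℕ) {B : Fin n → Fin n → ℝ}
    {τ m : Fin n → ℝ} (hB : ∀ i, realForm p (B i) m = 0) (hm : realForm p m m ≠ 0)
    (a b : Fin n → ℝ) :
    (Matrix.of fun i => toComplex (B i + τ i • a) (τ i • b)).det =
      (((Matrix.of fun i => B i + τ i • m).det / realForm p m m : ℝ) : ℂ) *
        ((realForm p a m : ℂ) + Complex.I * (realForm p b m : ℂ)) := by
  have h := det_of_add_smul (b := fun i => toComplex (B i) 0) (τ := fun i => (τ i : ℂ))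
    (m := toComplex m 0) (w := fun k => ((sgn p k * m k / realForm p m m : ℝ) : ℂ))
    (fun i => by rw [toComplex_zero_dotProduct, hB]; simp)
    (by rw [toComplex_zero_dotProduct, div_self hm]; simp) (toComplex a b)
  have h1 : (Matrix.of fun i => toComplex (B i + τ i • a) (τ i • b)) =
      Matrix.of fun i => toComplex (B i) 0 + (τ i : ℂ) • toComplex a b := by
    ext i j
    simp only [Matrix.of_apply, toComplex, Pi.add_apply, Pi.smul_apply, smul_eq_mul, Pi.zero_apply]
    push_cast
    ring
  have h2 : (Matrix.of fun i => toComplex (B i) 0 + (τ i : ℂ) • toComplex m 0) =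
      (Matrix.of fun i => B i + τ i • m).map (fun a : ℝ => (a : ℂ)) := by
    ext i j
    simp [toComplex]
  rw [h1, h, h2, det_map_ofReal, toComplex_dotProduct]
  push_cast
  ring

section Param

variable {n p : ℕ} {M : Matrix (Fin n) (Fin n) ℝ} {c : ℝ} {J : Set ℝ} {r : ℝ → ℝ}
  {U : Set (Fin n → ℝ)} {ψ : (Fin n → ℝ) → ℝ × (Fin n → ℝ)}

theorem mulVec_ne_zero_of_isUnit (hM : IsUnit M) {x : Fin n → ℝ} (hx : x ≠ 0) : M *ᵥ x ≠ 0 := by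
  intro h
  exact hx (Matrix.eq_zero_of_mulVec_eq_zero ((Matrix.isUnit_iff_isUnit_det _).1 hM).ne_zero h)

theorem realForm_mulVec_self_ne_zero (hM : IsUnit M) (hS : QuadricNondegenerate p M c)
    {x : Fin n → ℝ} (hx : x ∈ quadric p M c) : realForm p (M *ᵥ x) (M *ᵥ x) ≠ 0 := by
  intro h
  refine mulVec_ne_zero_of_isUnit hM hx.2 (hS.2 x hx _ h fun w hw => ?_)
  rwa [realForm_comm]

theorem evolvingMap_apply (M : Matrix (Fin n) (Fin n) ℝ) (r : ℝ → ℝ) (q : ℝ × (Fin n → ℝ)) :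
    evolvingMap M r q = (r q.1 : ℂ) • (expI M q.1 *ᵥ fun j => (q.2 j : ℂ)) := rfl

theorem contDiffOn_evolvingMap_comp (hr : ContDiffOn ℝ ∞ r J)
    (hψ : IsLocalParametrization (J ×ˢ quadric p M c) U ψ) :
    ContDiffOn ℝ ∞ (evolvingMap M r ∘ ψ) U := by
  have h1 : ContDiffOn ℝ ∞ (fun u => (ψ u).1) U := contDiff_fst.comp_contDiffOn hψ.contDiffOn
  have h2 : ContDiffOn ℝ ∞ (fun u => (ψ u).2) U := contDiff_snd.comp_contDiffOn hψ.contDiffOn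
  refine contDiffOn_pi.2 fun k => ?_
  have : ContDiffOn ℝ ∞ (fun u => (r (ψ u).1 : ℂ) *
      ∑ j, expI M (ψ u).1 k j * (((ψ u).2 j : ℝ) : ℂ)) U := by
    refine ContDiffOn.mul ?_ (ContDiffOn.sum fun j _ => ContDiffOn.mul ?_ ?_)
    · exact Complex.ofRealCLM.contDiff.comp_contDiffOn (hr.comp h1 fun u hu => (hψ.mapsTo hu).1)
    · exact (contDiff_expI M k j).comp_contDiffOn h1
    · exact Complex.ofRealCLM.contDiff.comp_contDiffOn (contDiffOn_pi.1 h2 j)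
  exact this

theorem differentiableAt_param (hψ : IsLocalParametrization (J ×ˢ quadric p M c) U ψ)
    {u : Fin n → ℝ} (hu : u ∈ U) : DifferentiableAt ℝ ψ u :=
  (hψ.contDiffOn.differentiableOn (by simp)).differentiableAt (hψ.isOpen.mem_nhds hu)

theorem hasDerivAt_param_fst (hψ : IsLocalParametrization (J ×ˢ quadric p M c) U ψ)
    {u : Fin n → ℝ} (hu : u ∈ U) (v : Fin n → ℝ) :
    HasDerivAt (fun t : ℝ => (ψ (u + t • v)).1) (fderiv ℝ ψ u v).1 0 :=
  (ContinuousLinearMap.fst ℝ ℝ (Fin n → ℝ)).hasFDerivAt.comp_hasDerivAt (0 : ℝ)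
    (hasDerivAt_line (differentiableAt_param hψ hu) v)

theorem hasDerivAt_param_snd (hψ : IsLocalParametrization (J ×ˢ quadric p M c) U ψ)
    {u : Fin n → ℝ} (hu : u ∈ U) (v : Fin n → ℝ) :
    HasDerivAt (fun t : ℝ => (ψ (u + t • v)).2) (fderiv ℝ ψ u v).2 0 :=
  (ContinuousLinearMap.snd ℝ ℝ (Fin n → ℝ)).hasFDerivAt.comp_hasDerivAt (0 : ℝ)
    (hasDerivAt_line (differentiableAt_param hψ hu) v)

theorem hasDerivAt_realForm {x y : ℝ → Fin n → ℝ} {x' y' : Fin n → ℝ} {t : ℝ}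
    (hx : HasDerivAt x x' t) (hy : HasDerivAt y y' t) :
    HasDerivAt (fun t => realForm p (x t) (y t)) (realForm p x' (y t) + realForm p (x t) y') t := by
  have : HasDerivAt (fun t => ∑ j, sgn p j * (x t j * y t j))
      (∑ j, sgn p j * (x' j * y t j + x t j * y' j)) t :=
    HasDerivAt.fun_sum fun j _ =>
      ((hasDerivAt_pi.1 hx j).mul (hasDerivAt_pi.1 hy j)).const_mul _
  simpa [realForm, mul_add, Finset.sum_add_distrib] using this

theorem hasDerivAt_mulVec {x : ℝ → Fin n → ℝ} {x' : Fin n → ℝ} {t : ℝ}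
    (hx : HasDerivAt x x' t) : HasDerivAt (fun t => M *ᵥ x t) (M *ᵥ x') t :=
  (LinearMap.toContinuousLinearMap M.mulVecLin).hasFDerivAt.comp_hasDerivAt t hx

theorem realForm_fderiv_snd
    (hsa : ∀ x y : Fin n → ℝ, realForm p (M *ᵥ x) y = realForm p x (M *ᵥ y))
    (hψ : IsLocalParametrization (J ×ˢ quadric p M c) U ψ) {u : Fin n → ℝ} (hu : u ∈ U)
    (v : Fin n → ℝ) : realForm p (fderiv ℝ ψ u v).2 (M *ᵥ (ψ u).2) = 0 := by
  have h1 := hasDerivAt_param_snd hψ hu v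
  have h2 := hasDerivAt_realForm (p := p) h1 (hasDerivAt_mulVec (M := M) h1)
  have h3 : (fun t : ℝ => realForm p (ψ (u + t • v)).2 (M *ᵥ (ψ (u + t • v)).2)) =ᶠ[nhds 0]
      fun _ => c := by
    filter_upwards [eventually_line_mem hψ.isOpen hu v] with t ht using (hψ.mapsTo ht).2.1
  have h4 := h2.unique ((hasDerivAt_const (0 : ℝ) c).congr_of_eventuallyEq h3)
  simp only [zero_smul, add_zero] at h4
  rw [← hsa (ψ u).2, realForm_comm p (M *ᵥ (ψ u).2)] at h4
  linarith

theorem fderiv_evolvingMap_comp (hJo : IsOpen J) (hr : ContDiffOn ℝ ∞ r J)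
    (hrpos : ∀ s ∈ J, 0 < r s)
    (hψ : IsLocalParametrization (J ×ˢ quadric p M c) U ψ) {u : Fin n → ℝ} (hu : u ∈ U)
    (v : Fin n → ℝ) :
    fderiv ℝ (evolvingMap M r ∘ ψ) u v = (r (ψ u).1 : ℂ) • (expI M (ψ u).1 *ᵥ
      toComplex ((fderiv ℝ ψ u v).2 +
          (fderiv ℝ ψ u v).1 • ((deriv r (ψ u).1 / r (ψ u).1) • (ψ u).2))
        ((fderiv ℝ ψ u v).1 • (M *ᵥ (ψ u).2))) := by
  have hs : (ψ u).1 ∈ J := (hψ.mapsTo hu).1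
  have hF := contDiffOn_evolvingMap_comp hr hψ
  have hd := hasDerivAt_line ((hF.differentiableOn (by simp)).differentiableAt
    (hψ.isOpen.mem_nhds hu)) v
  have hσ := hasDerivAt_param_fst hψ hu v
  have hξ := hasDerivAt_param_snd hψ hu v
  have hr' : HasDerivAt r (deriv r (ψ u).1) (ψ (u + (0 : ℝ) • v)).1 := by
    simpa using ((hr.differentiableOn (by simp)).differentiableAt (hJo.mem_nhds hs)).hasDerivAt
  have hrσ := (hr'.comp (0 : ℝ) hσ).ofReal_comp
  ext k
  have hd2 : HasDerivAt (fun t : ℝ => (r (ψ (u + t • v)).1 : ℂ) *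
      ∑ j, expI M (ψ (u + t • v)).1 k j * (((ψ (u + t • v)).2 j : ℝ) : ℂ))
      (fderiv ℝ (evolvingMap M r ∘ ψ) u v k) 0 := hasDerivAt_pi.1 hd k
  have hd3 := hrσ.mul (HasDerivAt.fun_sum (u := Finset.univ) fun j _ =>
    ((hasDerivAt_expI M _ k j).scomp (0 : ℝ) hσ).mul (hasDerivAt_pi.1 hξ j).ofReal_comp)
  rw [hd2.unique hd3]
  have hr0 : (r (ψ u).1 : ℂ) ≠ 0 := by exact_mod_cast (hrpos _ hs).ne'
  have hexp : ∑ j, (expI M (ψ u).1 * (Complex.I • M.map (fun a : ℝ => (a : ℂ)))) k j *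
      (((ψ u).2 j : ℝ) : ℂ) = Complex.I * ∑ j, expI M (ψ u).1 k j * ((M *ᵥ (ψ u).2) j : ℂ) := by
    have h1 : (fun j => ((M *ᵥ (ψ u).2) j : ℂ)) =
        M.map (fun a : ℝ => (a : ℂ)) *ᵥ fun j => (((ψ u).2 j : ℝ) : ℂ) := by
      ext j
      simp [Matrix.mulVec, dotProduct]
    change ((expI M (ψ u).1 * (Complex.I • M.map (fun a : ℝ => (a : ℂ)))) *ᵥ
      (fun j => (((ψ u).2 j : ℝ) : ℂ))) k = Complex.I * (expI M (ψ u).1 *ᵥ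
        (fun j => ((M *ᵥ (ψ u).2) j : ℂ))) k
    rw [h1, Matrix.mulVec_mulVec, Matrix.mul_smul, Matrix.smul_mulVec]
    rfl
  have hsplit : ∑ j, expI M (ψ u).1 k j * toComplex ((fderiv ℝ ψ u v).2 +
          (fderiv ℝ ψ u v).1 • ((deriv r (ψ u).1 / r (ψ u).1) • (ψ u).2))
        ((fderiv ℝ ψ u v).1 • (M *ᵥ (ψ u).2)) j =
      ∑ j, expI M (ψ u).1 k j * ((fderiv ℝ ψ u v).2 j : ℂ) +
      ((fderiv ℝ ψ u v).1 : ℂ) * (((deriv r (ψ u).1 : ℝ) : ℂ) / r (ψ u).1) *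
        ∑ j, expI M (ψ u).1 k j * (((ψ u).2 j : ℝ) : ℂ) +
      ((fderiv ℝ ψ u v).1 : ℂ) *
        (Complex.I * ∑ j, expI M (ψ u).1 k j * ((M *ᵥ (ψ u).2) j : ℂ)) := by
    simp only [Finset.mul_sum, ← Finset.sum_add_distrib]
    refine Finset.sum_congr rfl fun j _ => ?_
    simp only [toComplex, Pi.add_apply, Pi.smul_apply, smul_eq_mul]
    push_cast
    ring
  change _ = (r (ψ u).1 : ℂ) * ∑ j, _
  rw [hsplit, ← hexp]
  simp only [zero_smul, add_zero, Finset.sum_add_distrib, Pi.mul_apply, Function.comp_apply,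
    Complex.real_smul, Complex.ofReal_mul, zero_smul, add_zero, mul_assoc, ← Finset.mul_sum]
  field_simp
  ring

end Param

/-! ### The Lagrangian angle of the evolving map -/

section Param

variable {n p : ℕ} {M : Matrix (Fin n) (Fin n) ℝ} {c : ℝ} {J : Set ℝ} {r : ℝ → ℝ}
  {U : Set (Fin n → ℝ)} {ψ : (Fin n → ℝ) → ℝ × (Fin n → ℝ)}

theorem im_herm_fderiv_evolvingMap_comp
    (hsa : ∀ x y : Fin n → ℝ, realForm p (M *ᵥ x) y = realForm p x (M *ᵥ y))
    (hJo : IsOpen J) (hr : ContDiffOn ℝ ∞ r J) (hrpos : ∀ s ∈ J, 0 < r s)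
    (hψ : IsLocalParametrization (J ×ˢ quadric p M c) U ψ) {u : Fin n → ℝ} (hu : u ∈ U)
    (v w : Fin n → ℝ) :
    (herm p (fderiv ℝ (evolvingMap M r ∘ ψ) u v) (fderiv ℝ (evolvingMap M r ∘ ψ) u w)).im = 0 := by
  rw [fderiv_evolvingMap_comp hJo hr hrpos hψ hu, fderiv_evolvingMap_comp hJo hr hrpos hψ hu,
    herm_smul_smul, herm_expI hsa, ← Complex.ofReal_pow, Complex.im_ofReal_mul, herm_toComplex]
  have h1 := realForm_fderiv_snd hsa hψ hu v
  have h2 := realForm_fderiv_snd hsa hψ hu w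
  rw [realForm_comm] at h2
  simp only [realForm_add_left, realForm_add_right, realForm_smul_left, realForm_smul_right, h1, h2,
    realForm_comm p (M *ᵥ (ψ u).2) (ψ u).2]
  ring

theorem toComplex_eq_zero {a b : Fin n → ℝ} (h : toComplex a b = 0) : a = 0 ∧ b = 0 := by
  refine ⟨funext fun j => ?_, funext fun j => ?_⟩
  · simpa [toComplex] using congrArg Complex.re (congrFun h j)
  · simpa [toComplex] using congrArg Complex.im (congrFun h j)

theorem injective_fderiv_evolvingMap_comp (hM : IsUnit M) (hJo : IsOpen J)
    (hr : ContDiffOn ℝ ∞ r J) (hrpos : ∀ s ∈ J, 0 < r s)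
    (hψ : IsLocalParametrization (J ×ˢ quadric p M c) U ψ) {u : Fin n → ℝ} (hu : u ∈ U) :
    Function.Injective (fderiv ℝ (evolvingMap M r ∘ ψ) u) := by
  refine (injective_iff_map_eq_zero _).2 fun v hv => ?_
  rw [fderiv_evolvingMap_comp hJo hr hrpos hψ hu] at hv
  have hr0 : (r (ψ u).1 : ℂ) ≠ 0 := by exact_mod_cast (hrpos _ (hψ.mapsTo hu).1).ne'
  have h1 := (smul_eq_zero.1 hv).resolve_left hr0
  have h2 := Matrix.eq_zero_of_mulVec_eq_zero
    ((Matrix.isUnit_iff_isUnit_det _).1 (isUnit_expI M (ψ u).1)).ne_zero h1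
  obtain ⟨h3, h4⟩ := toComplex_eq_zero h2
  have h5 : (fderiv ℝ ψ u v).1 = 0 :=
    (smul_eq_zero.1 h4).resolve_right (mulVec_ne_zero_of_isUnit hM (hψ.mapsTo hu).2.2)
  rw [h5, zero_smul, add_zero] at h3
  refine (injective_iff_map_eq_zero _).1 (hψ.injective_fderiv u hu) v ?_
  exact Prod.ext h5 h3

/-- The determinant of the real basis `∂_i ξ + (∂_i σ) M ξ` of `ℝⁿ`, where `ψ = (σ, ξ)`. -/
noncomputable def frameDet (M : Matrix (Fin n) (Fin n) ℝ) (ψ : (Fin n → ℝ) → ℝ × (Fin n → ℝ))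
    (u : Fin n → ℝ) : ℝ :=
  (Matrix.of fun i => (fderiv ℝ ψ u (Pi.single i 1)).2 +
    (fderiv ℝ ψ u (Pi.single i 1)).1 • (M *ᵥ (ψ u).2)).det

theorem frameDet_ne_zero (hM : IsUnit M)
    (hsa : ∀ x y : Fin n → ℝ, realForm p (M *ᵥ x) y = realForm p x (M *ᵥ y))
    (hS : QuadricNondegenerate p M c)
    (hψ : IsLocalParametrization (J ×ˢ quadric p M c) U ψ) {u : Fin n → ℝ} (hu : u ∈ U) :
    frameDet M ψ u ≠ 0 := by
  intro h
  obtain ⟨v, hv, hv0⟩ := Matrix.exists_vecMul_eq_zero_iff.2 h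
  refine hv ((injective_iff_map_eq_zero _).1 (hψ.injective_fderiv u hu) v ?_)
  have hsum : v ᵥ* (Matrix.of fun i => (fderiv ℝ ψ u (Pi.single i 1)).2 +
      (fderiv ℝ ψ u (Pi.single i 1)).1 • (M *ᵥ (ψ u).2)) =
      (fderiv ℝ ψ u v).2 + (fderiv ℝ ψ u v).1 • (M *ᵥ (ψ u).2) := by
    rw [clm_apply_eq_sum_single (fderiv ℝ ψ u) v, Prod.fst_sum, Prod.snd_sum, Finset.sum_smul,
      ← Finset.sum_add_distrib]
    ext j
    rw [Finset.sum_apply]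
    change ∑ i : Fin n, _ = _
    refine Finset.sum_congr rfl fun i _ => ?_
    simp [mul_add, mul_assoc]
  rw [hsum] at hv0
  have h1 := congrArg (fun x => realForm p x (M *ᵥ (ψ u).2)) hv0
  simp only [realForm_add_left, realForm_smul_left, realForm_fderiv_snd hsa hψ hu, zero_add,
    realForm_zero_left] at h1
  have h2 := (mul_eq_zero.1 h1).resolve_right
    (realForm_mulVec_self_ne_zero hM hS (hψ.mapsTo hu).2)
  rw [h2, zero_smul, add_zero] at hv0
  exact Prod.ext h2 hv0

/-- The complex number whose argument is the Lagrangian angle of the evolving map: it is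
`det(e^{iMs}) (ρ c + i ⟨M x, M x⟩)`, where `ρ = r' / r`. -/
noncomputable def phase (p : ℕ) (M : Matrix (Fin n) (Fin n) ℝ) (c : ℝ) (r : ℝ → ℝ)
    (q : ℝ × (Fin n → ℝ)) : ℂ :=
  (expI M q.1).det * (((deriv r q.1 / r q.1 * c : ℝ) : ℂ) +
    Complex.I * (realForm p (M *ᵥ q.2) (M *ᵥ q.2) : ℂ))

theorem jacDet_evolvingMap_comp (hM : IsUnit M)
    (hsa : ∀ x y : Fin n → ℝ, realForm p (M *ᵥ x) y = realForm p x (M *ᵥ y))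
    (hS : QuadricNondegenerate p M c) (hJo : IsOpen J)
    (hr : ContDiffOn ℝ ∞ r J) (hrpos : ∀ s ∈ J, 0 < r s)
    (hψ : IsLocalParametrization (J ×ˢ quadric p M c) U ψ) {u : Fin n → ℝ} (hu : u ∈ U) :
    jacDet (evolvingMap M r ∘ ψ) u =
      ((r (ψ u).1 ^ n * (frameDet M ψ u / realForm p (M *ᵥ (ψ u).2) (M *ᵥ (ψ u).2)) : ℝ) : ℂ) *
        phase p M c r (ψ u) := by
  have hjac : jac (evolvingMap M r ∘ ψ) u = (r (ψ u).1 : ℂ) •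
      ((Matrix.of fun i => toComplex ((fderiv ℝ ψ u (Pi.single i 1)).2 +
          (fderiv ℝ ψ u (Pi.single i 1)).1 • ((deriv r (ψ u).1 / r (ψ u).1) • (ψ u).2))
        ((fderiv ℝ ψ u (Pi.single i 1)).1 • (M *ᵥ (ψ u).2))) * (expI M (ψ u).1)ᵀ) := by
    ext i k
    simp only [jac, Matrix.of_apply]
    rw [fderiv_evolvingMap_comp hJo hr hrpos hψ hu, Matrix.smul_apply, Matrix.mul_apply]
    simp only [Pi.smul_apply, Matrix.mulVec, dotProduct, Matrix.transpose_apply, Matrix.of_apply]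
    congr 1
    exact Finset.sum_congr rfl fun j _ => mul_comm _ _
  have hx := (hψ.mapsTo hu).2
  rw [jacDet, hjac, Matrix.det_smul, Matrix.det_mul, Matrix.det_transpose, Fintype.card_fin,
    det_add_smul_toComplex p (fun i => realForm_fderiv_snd hsa hψ hu _)
      (realForm_mulVec_self_ne_zero hM hS hx), phase, frameDet, realForm_smul_left, hx.1]
  push_cast
  ring

theorem det_expI_ne_zero (M : Matrix (Fin n) (Fin n) ℝ) (s : ℝ) : (expI M s).det ≠ 0 :=
  ((Matrix.isUnit_iff_isUnit_det _).1 (isUnit_expI M s)).ne_zero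

theorem phase_ne_zero (hM : IsUnit M) (hS : QuadricNondegenerate p M c) {q : ℝ × (Fin n → ℝ)}
    (hq : q.2 ∈ quadric p M c) : phase p M c r q ≠ 0 := by
  refine mul_ne_zero (det_expI_ne_zero M _) fun h => ?_
  have := congrArg Complex.im h
  simp at this
  exact realForm_mulVec_self_ne_zero hM hS hq this

theorem jacDet_evolvingMap_comp_ne_zero (hM : IsUnit M)
    (hsa : ∀ x y : Fin n → ℝ, realForm p (M *ᵥ x) y = realForm p x (M *ᵥ y))
    (hS : QuadricNondegenerate p M c) (hJo : IsOpen J)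
    (hr : ContDiffOn ℝ ∞ r J) (hrpos : ∀ s ∈ J, 0 < r s)
    (hψ : IsLocalParametrization (J ×ˢ quadric p M c) U ψ) {u : Fin n → ℝ} (hu : u ∈ U) :
    jacDet (evolvingMap M r ∘ ψ) u ≠ 0 := by
  rw [jacDet_evolvingMap_comp hM hsa hS hJo hr hrpos hψ hu]
  have hx := (hψ.mapsTo hu).2
  refine mul_ne_zero (Complex.ofReal_ne_zero.2 (mul_ne_zero
    (pow_ne_zero _ (hrpos _ (hψ.mapsTo hu).1).ne') (div_ne_zero
      (frameDet_ne_zero hM hsa hS hψ hu) (realForm_mulVec_self_ne_zero hM hS hx))))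
    (phase_ne_zero hM hS hx)

theorem hasDerivAt_im_eq_zero {f : ℝ → ℂ} {f' : ℂ} {t : ℝ} (h : HasDerivAt f f' t)
    (him : ∀ᶠ s in nhds t, (f s).im = 0) : f'.im = 0 := by
  have h1 : HasDerivAt (fun s => (f s).im) f'.im t := Complex.imCLM.hasFDerivAt.comp_hasDerivAt t h
  exact h1.unique ((hasDerivAt_const t (0 : ℝ)).congr_of_eventuallyEq him)

/-- Real factors do not contribute to the derivative of the argument. -/
theorem im_conj_mul_deriv_of_eq_mul {D P : ℝ → ℂ} {a : ℝ → ℝ} {D' P' : ℂ} {t : ℝ}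
    (hD : HasDerivAt D D' t) (hP : HasDerivAt P P' t) (hP0 : P t ≠ 0)
    (h : ∀ᶠ s in nhds t, D s = a s * P s) :
    ((starRingEnd ℂ) (D t) * D').im = a t ^ 2 * ((starRingEnd ℂ) (P t) * P').im := by
  have hquot := hD.div hP hP0
  have him := hasDerivAt_im_eq_zero hquot (by
    filter_upwards [h, hP.continuousAt.eventually_ne hP0] with s hs hs0
    rw [Pi.div_apply, hs, mul_div_assoc, div_self hs0, mul_one, Complex.ofReal_im])
  have hDt := h.self_of_nhds
  set b := (D' * P t - D t * P') / P t ^ 2 with hb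
  have hD' : D' = b * P t + a t * P' := by
    rw [hb, hDt]
    field_simp
    ring
  rw [hDt, hD', map_mul, Complex.conj_ofReal]
  have e : (a t : ℂ) * (starRingEnd ℂ) (P t) * (b * P t + a t * P') =
      ((a t * Complex.normSq (P t) : ℝ) : ℂ) * b +
        ((a t ^ 2 : ℝ) : ℂ) * ((starRingEnd ℂ) (P t) * P') := by
    push_cast
    rw [Complex.normSq_eq_conj_mul_self]
    ring
  rw [e, Complex.add_im, Complex.im_ofReal_mul, Complex.im_ofReal_mul, him]
  ring

/-- The evolving map is critical for the volume if and only if the derivative of its Lagrangian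
angle, which is `tr M ds + d arg(ρ c + i ⟨M x, M x⟩)`, vanishes. -/
theorem isVolumeCritical_evolvingMap_comp_iff (hM : IsUnit M)
    (hsa : ∀ x y : Fin n → ℝ, realForm p (M *ᵥ x) y = realForm p x (M *ᵥ y))
    (hS : QuadricNondegenerate p M c) (hJo : IsOpen J)
    (hr : ContDiffOn ℝ ∞ r J) (hrpos : ∀ s ∈ J, 0 < r s)
    (hψ : IsLocalParametrization (J ×ˢ quadric p M c) U ψ) :
    IsVolumeCritical p U (evolvingMap M r ∘ ψ) ↔ ∀ u ∈ U, ∀ v,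
      M.trace * (fderiv ℝ ψ u v).1 * ((deriv r (ψ u).1 / r (ψ u).1 * c) ^ 2 +
          realForm p (M *ᵥ (ψ u).2) (M *ᵥ (ψ u).2) ^ 2) +
        c * (deriv r (ψ u).1 / r (ψ u).1 *
            (2 * realForm p (M *ᵥ (fderiv ℝ ψ u v).2) (M *ᵥ (ψ u).2)) -
          realForm p (M *ᵥ (ψ u).2) (M *ᵥ (ψ u).2) *
            (deriv (fun s => deriv r s / r s) (ψ u).1 * (fderiv ℝ ψ u v).1)) = 0 := by
  have hF := contDiffOn_evolvingMap_comp hr hψ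
  rw [isVolumeCritical_iff hψ.isOpen hF (fun u hu i j =>
    im_herm_fderiv_evolvingMap_comp hsa hJo hr hrpos hψ hu _ _)
    (fun u hu => jacDet_evolvingMap_comp_ne_zero hM hsa hS hJo hr hrpos hψ hu)]
  refine forall₂_congr fun u hu => forall_congr' fun v => ?_
  have hs : (ψ u).1 ∈ J := (hψ.mapsTo hu).1
  have hx := (hψ.mapsTo hu).2
  have hσ := hasDerivAt_param_fst hψ hu v
  have hMξ := hasDerivAt_mulVec (M := M) (hasDerivAt_param_snd hψ hu v)
  have hρ : HasDerivAt (fun s => deriv r s / r s) (deriv (fun s => deriv r s / r s) (ψ u).1)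
      (ψ (u + (0 : ℝ) • v)).1 := by
    have h1 : ContDiffOn ℝ ∞ (deriv r) J := hr.deriv_of_isOpen hJo (by simp)
    have h2 := (h1.div hr fun s hs => (hrpos s hs).ne').differentiableOn (by simp)
    have h3 : HasDerivAt (fun s => deriv r s / r s) _ (ψ u).1 :=
      (h2.differentiableAt (hJo.mem_nhds hs)).hasDerivAt
    rwa [zero_smul, add_zero]
  have hP := ((hasDerivAt_det_expI M _).scomp (0 : ℝ) hσ).mul
    (((hρ.comp (0 : ℝ) hσ).mul_const c).ofReal_comp.add
      ((hasDerivAt_realForm (p := p) hMξ hMξ).ofReal_comp.const_mul Complex.I))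
  have hP2 : HasDerivAt (fun t : ℝ => phase p M c r (ψ (u + t • v))) _ 0 := hP
  have hD := hasDerivAt_line (((contDiffOn_jacDet hψ.isOpen hF).differentiableOn
    (by simp)).differentiableAt (hψ.isOpen.mem_nhds hu)) v
  have hev := eventually_line_mem hψ.isOpen hu v
  have key := im_conj_mul_deriv_of_eq_mul hD hP2
    (by simpa using phase_ne_zero hM hS hx) (hev.mono fun t ht =>
      jacDet_evolvingMap_comp hM hsa hS hJo hr hrpos hψ ht)
  simp only [zero_smul, add_zero] at key
  rw [key]
  have ha : (r (ψ u).1 ^ n * (frameDet M ψ u /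
      realForm p (M *ᵥ (ψ u).2) (M *ᵥ (ψ u).2))) ^ 2 ≠ 0 :=
    pow_ne_zero _ (mul_ne_zero (pow_ne_zero _ (hrpos _ hs).ne') (div_ne_zero
      (frameDet_ne_zero hM hsa hS hψ hu) (realForm_mulVec_self_ne_zero hM hS hx)))
  rw [mul_eq_zero, or_iff_right ha]
  have hN := Complex.normSq_pos.2 (det_expI_ne_zero M (ψ u).1)
  refine Iff.trans (Eq.congr ?_ rfl) (mul_eq_zero.trans (or_iff_right hN.ne'))
  simp only [phase, Function.comp_apply, Pi.add_apply, zero_smul, add_zero, Complex.real_smul]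
  rw [realForm_comm p (M *ᵥ (ψ u).2) (M *ᵥ (fderiv ℝ ψ u v).2)]
  generalize (expI M (ψ u).1).det = h
  generalize deriv (fun s => deriv r s / r s) (ψ u).1 = ρ'
  generalize deriv r (ψ u).1 / r (ψ u).1 = ρ
  simp only [Complex.normSq_apply, Complex.mul_im, Complex.mul_re, Complex.add_re, Complex.add_im,
    Complex.conj_re, Complex.conj_im, Complex.ofReal_re, Complex.ofReal_im, Complex.I_re,
    Complex.I_im]
  ring

end Param

/-! ### Local parametrizations of the quadric -/

theorem contDiff_realForm {X : Type*} [NormedAddCommGroup X] [NormedSpace ℝ X] {n : ℕ} (p : ℕ)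
    {f g : X → Fin n → ℝ} (hf : ContDiff ℝ ∞ f) (hg : ContDiff ℝ ∞ g) :
    ContDiff ℝ ∞ fun u => realForm p (f u) (g u) :=
  ContDiff.sum fun j _ => contDiff_const.mul ((contDiff_pi.1 hf j).mul (contDiff_pi.1 hg j))

/-- The projection onto the hyperplane `m^⊥` along `m`. -/
noncomputable def orthProj {n : ℕ} (p : ℕ) (m u : Fin n → ℝ) : Fin n → ℝ :=
  u - (realForm p u m / realForm p m m) • m

section OrthProj

variable {n p : ℕ} {m : Fin n → ℝ}

theorem realForm_sub_left (x y z : Fin n → ℝ) :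
    realForm p (x - y) z = realForm p x z - realForm p y z := by
  rw [sub_eq_add_neg, realForm_add_left, ← neg_one_smul ℝ y, realForm_smul_left]
  ring

theorem realForm_orthProj (hm : realForm p m m ≠ 0) (u : Fin n → ℝ) :
    realForm p (orthProj p m u) m = 0 := by
  rw [orthProj, realForm_sub_left, realForm_smul_left, div_mul_cancel₀ _ hm, sub_self]

theorem orthProj_eq_self {u : Fin n → ℝ} (hu : realForm p u m = 0) : orthProj p m u = u := by
  simp [orthProj, hu]

theorem orthProj_add_smul (hm : realForm p m m ≠ 0) (u : Fin n → ℝ) (a : ℝ) :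
    orthProj p m (u + a • m) = orthProj p m u := by
  simp only [orthProj, realForm_add_left, realForm_smul_left, add_div, mul_div_assoc, div_self hm,
    mul_one, add_smul]
  abel

theorem contDiff_orthProj : ContDiff ℝ ∞ (orthProj p m) :=
  contDiff_id.sub (((contDiff_realForm p contDiff_id contDiff_const).div_const _).smul
    contDiff_const)

theorem hasDerivAt_orthProj {x : ℝ → Fin n → ℝ} {x' : Fin n → ℝ} {t : ℝ} (hx : HasDerivAt x x' t) :
    HasDerivAt (fun t => orthProj p m (x t)) (orthProj p m x') t := by
  have h := hx.sub (((hasDerivAt_realForm (p := p) hx (hasDerivAt_const t m)).div_const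
    (realForm p m m)).smul_const m)
  refine h.congr_deriv ?_
  rw [realForm_comm p (x t) 0, realForm_zero_left, add_zero, orthProj]

end OrthProj

/-- Every point `(s₀, x₀)` of `J × 𝒮` lies in a local parametrization, whose differential there maps
onto `ℝ × T_{x₀} 𝒮`. With `m = M x₀`, the points of `𝒮` near `x₀` are written as `x₀ + v + g m`,
where `v ∈ m^⊥` and `g` is the small root of a quadratic equation. -/
theorem exists_isLocalParametrization {n p : ℕ} {M : Matrix (Fin n) (Fin n) ℝ} (hM : IsUnit M)
    (hsa : ∀ x y : Fin n → ℝ, realForm p (M *ᵥ x) y = realForm p x (M *ᵥ y))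
    {c : ℝ} (hS : QuadricNondegenerate p M c) {J : Set ℝ} (hJo : IsOpen J) {s₀ : ℝ} (hs : s₀ ∈ J)
    {x₀ : Fin n → ℝ} (hx : x₀ ∈ quadric p M c) :
    ∃ U ψ, IsLocalParametrization (J ×ˢ quadric p M c) U ψ ∧ ∃ u ∈ U, ψ u = (s₀, x₀) ∧
      (∃ v, fderiv ℝ ψ u v = (1, 0)) ∧
      ∀ w, realForm p w (M *ᵥ x₀) = 0 → ∃ v, fderiv ℝ ψ u v = (0, w) := by
  set m := M *ᵥ x₀ with hmdef
  have hm : realForm p m m ≠ 0 := realForm_mulVec_self_ne_zero hM hS hx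
  set P : (Fin n → ℝ) → (Fin n → ℝ) := orthProj p m with hP
  have hPs : ContDiff ℝ ∞ P := contDiff_orthProj
  have hMs : ∀ {f : (Fin n → ℝ) → (Fin n → ℝ)}, ContDiff ℝ ∞ f → ContDiff ℝ ∞ fun u => M *ᵥ f u :=
    fun hf => (LinearMap.toContinuousLinearMap M.mulVecLin).contDiff.comp hf
  -- the equation for `g` is `C g² + 2 B g + A = 0`
  set A : (Fin n → ℝ) → ℝ := fun u => realForm p (P u) (M *ᵥ P u) with hA
  set B : (Fin n → ℝ) → ℝ := fun u => realForm p (x₀ + P u) (M *ᵥ m) with hB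
  set C : ℝ := realForm p m (M *ᵥ m) with hC
  have hAs : ContDiff ℝ ∞ A := contDiff_realForm p hPs (hMs hPs)
  have hBs : ContDiff ℝ ∞ B := contDiff_realForm p (contDiff_const.add hPs) contDiff_const
  have hls : ContDiff ℝ ∞ fun u : Fin n → ℝ => s₀ + realForm p u m :=
    contDiff_const.add (contDiff_realForm p contDiff_id contDiff_const)
  set g : (Fin n → ℝ) → ℝ := fun u => -A u / (B u * (1 + Real.sqrt (1 - A u * C / B u ^ 2)))
    with hg
  set ξ : (Fin n → ℝ) → (Fin n → ℝ) := fun u => x₀ + P u + g u • m with hξ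
  set ψ : (Fin n → ℝ) → ℝ × (Fin n → ℝ) := fun u => (s₀ + realForm p u m, ξ u) with hψ
  set U₁ : Set (Fin n → ℝ) := {u | s₀ + realForm p u m ∈ J ∧ B u ≠ 0 ∧ 0 < B u ^ 2 - A u * C}
    with hU₁
  have hU₁o : IsOpen U₁ := by
    have hcont : Continuous fun u => B u ^ 2 - A u * C :=
      ((hBs.pow 2).sub (hAs.mul contDiff_const)).continuous
    exact (hJo.preimage hls.continuous).inter ((isOpen_ne_fun hBs.continuous
      continuous_const).inter (isOpen_lt continuous_const hcont))
  have hdisc : ∀ u ∈ U₁, 0 < 1 - A u * C / B u ^ 2 := by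
    intro u hu
    have hB2 : 0 < B u ^ 2 := by have := hu.2.1; positivity
    rw [sub_pos, div_lt_one hB2]
    linarith [hu.2.2]
  have hgs : ContDiffOn ℝ ∞ g U₁ := by
    refine hAs.neg.contDiffOn.div (hBs.contDiffOn.mul (contDiffOn_const.add
      (ContDiffOn.sqrt (contDiffOn_const.sub ((hAs.mul contDiff_const).contDiffOn.div
        (hBs.pow 2).contDiffOn fun u hu => pow_ne_zero 2 hu.2.1)) fun u hu =>
          (hdisc u hu).ne'))) fun u hu => mul_ne_zero hu.2.1 ?_
    positivity
  have hξs : ContDiffOn ℝ ∞ ξ U₁ :=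
    (contDiff_const.add hPs).contDiffOn.add (hgs.smul contDiffOn_const)
  set U : Set (Fin n → ℝ) := U₁ ∩ ξ ⁻¹' {0}ᶜ with hU
  have hUo : IsOpen U := hξs.continuousOn.isOpen_inter_preimage hU₁o isOpen_compl_singleton
  have hψs : ContDiffOn ℝ ∞ ψ U := hls.contDiffOn.prodMk (hξs.mono Set.inter_subset_left)
  have hroot : ∀ u ∈ U₁, C * g u ^ 2 + 2 * B u * g u + A u = 0 := by
    intro u hu
    have hB0 := hu.2.1
    have hw := Real.sq_sqrt (hdisc u hu).le
    have hw0 := Real.sqrt_nonneg (1 - A u * C / B u ^ 2)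
    simp only [hg]
    set w := Real.sqrt (1 - A u * C / B u ^ 2) with hwdef
    have hw1 : 1 + w ≠ 0 := by positivity
    have hAC : A u * C = B u ^ 2 * (1 - w ^ 2) := by
      rw [hw]; field_simp; ring
    field_simp
    linear_combination A u * hAC
  have hquad : ∀ u ∈ U₁, realForm p (ξ u) (M *ᵥ ξ u) = c := by
    intro u hu
    have h1 : realForm p (P u) m = 0 := realForm_orthProj hm u
    have h2 : realForm p x₀ (M *ᵥ P u) = 0 := by rw [← hsa, realForm_comm]; exact h1
    have h3 : realForm p m (M *ᵥ (x₀ + P u)) = B u := by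
      rw [← hsa, realForm_comm]
    have h4 : realForm p (x₀ + P u) (M *ᵥ (x₀ + P u)) = c + A u := by
      rw [Matrix.mulVec_add, realForm_add_left, realForm_add_right, realForm_add_right, h2,
        ← hmdef, h1, hx.1]
      ring
    have h5 : realForm p (ξ u) (M *ᵥ ξ u) = c + (C * g u ^ 2 + 2 * B u * g u + A u) := by
      simp only [hξ]
      rw [Matrix.mulVec_add, realForm_add_left, realForm_add_right, realForm_add_right, h4,
        Matrix.mulVec_smul, realForm_smul_left, realForm_smul_right, realForm_smul_left,
        realForm_smul_right, h3]
      ring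
    rw [h5, hroot u hu, add_zero]
  -- a left inverse of `ψ`
  have hinv : ∀ u, orthProj p m ((ψ u).2 - x₀) + (((ψ u).1 - s₀) / realForm p m m) • m = u := by
    intro u
    have e : (ψ u).2 - x₀ = P u + g u • m := by simp only [hψ, hξ]; abel
    rw [e, orthProj_add_smul hm, hP, orthProj_eq_self (realForm_orthProj hm u)]
    simp only [hψ, add_sub_cancel_left, orthProj, sub_add_cancel]
  have hdiff : ∀ u ∈ U, DifferentiableAt ℝ ψ u := fun u hu =>
    (hψs.differentiableOn (by simp)).differentiableAt (hUo.mem_nhds hu)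
  have hinv' : ∀ u ∈ U, ∀ v, orthProj p m (fderiv ℝ ψ u v).2 +
      ((fderiv ℝ ψ u v).1 / realForm p m m) • m = v := by
    intro u hu v
    have h1 := hasDerivAt_line (hdiff u hu) v
    have h2 : HasDerivAt (fun t : ℝ => (ψ (u + t • v)).2) (fderiv ℝ ψ u v).2 0 :=
      (ContinuousLinearMap.snd ℝ ℝ (Fin n → ℝ)).hasFDerivAt.comp_hasDerivAt (0 : ℝ) h1
    have h3 : HasDerivAt (fun t : ℝ => (ψ (u + t • v)).1) (fderiv ℝ ψ u v).1 0 :=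
      (ContinuousLinearMap.fst ℝ ℝ (Fin n → ℝ)).hasFDerivAt.comp_hasDerivAt (0 : ℝ) h1
    have h4 := (hasDerivAt_orthProj (p := p) (m := m) (h2.sub_const x₀)).add
      (((h3.sub_const s₀).div_const (realForm p m m)).smul_const m)
    have h5 : HasDerivAt (fun t : ℝ => u + t • v) v 0 := by
      simpa using ((hasDerivAt_id (0 : ℝ)).smul_const v).const_add u
    exact h4.unique (h5.congr_of_eventuallyEq (Filter.Eventually.of_forall fun t => hinv _))
  have hparam : IsLocalParametrization (J ×ˢ quadric p M c) U ψ :=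
    { isOpen := hUo
      contDiffOn := hψs
      mapsTo := fun u hu => ⟨hu.1.1, hquad u hu.1, hu.2⟩
      injOn := fun u _ v _ huv => by rw [← hinv u, huv, hinv v]
      injective_fderiv := fun u hu => (injective_iff_map_eq_zero _).2 fun v hv => by
        rw [← hinv' u hu v, hv]
        simp [orthProj, realForm_zero_left] }
  have hP0 : P 0 = 0 := by simp [hP, orthProj, realForm_zero_left]
  have hA0 : A 0 = 0 := by simp [hA, hP0, realForm_zero_left]
  have hB0 : B 0 = realForm p m m := by simp only [hB, hP0, add_zero]; rw [← hsa]
  have hξ0 : ξ 0 = x₀ := by simp [hξ, hP0, hg, hA0]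
  have hψ0 : ψ 0 = (s₀, x₀) := by simp [hψ, hξ0, realForm_zero_left]
  have h0U : (0 : Fin n → ℝ) ∈ U := by
    refine ⟨⟨by simpa [realForm_zero_left] using hs, by rwa [hB0], ?_⟩, ?_⟩
    · rw [hA0, hB0, zero_mul, sub_zero]; positivity
    · simpa [hξ0] using hx.2
  have hfst : ∀ v, (fderiv ℝ ψ 0 v).1 = realForm p v m := by
    intro v
    have h1 := hasDerivAt_param_fst hparam h0U v
    have h2 : HasDerivAt (fun t : ℝ => s₀ + t * realForm p v m) (realForm p v m) 0 := by
      simpa using ((hasDerivAt_id (0 : ℝ)).mul_const (realForm p v m)).const_add s₀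
    refine h1.unique (h2.congr_of_eventuallyEq (Filter.Eventually.of_forall fun t => ?_))
    simp [hψ, realForm_smul_left]
  have hsnd : ∀ v, (fderiv ℝ ψ 0 v).2 = v - (realForm p v m / realForm p m m) • m := by
    intro v
    have h1 := hinv' 0 h0U v
    have h2 := realForm_fderiv_snd hsa hparam h0U v
    rw [hψ0] at h2
    rw [orthProj_eq_self h2, hfst] at h1
    exact eq_sub_of_add_eq h1
  refine ⟨U, ψ, hparam, 0, h0U, hψ0, ⟨(realForm p m m)⁻¹ • m, ?_⟩, fun w hw => ⟨w, ?_⟩⟩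
  · refine Prod.ext ?_ ?_
    · rw [hfst, realForm_smul_left, inv_mul_cancel₀ hm]
    · rw [hsnd, realForm_smul_left, inv_mul_cancel₀ hm, one_div, sub_self]
  · refine Prod.ext ?_ ?_
    · rw [hfst, hw]
    · rw [hsnd, hw]; simp

theorem det_inducedMetric_ne_zero {n p : ℕ} {F : (Fin n → ℝ) → (Fin n → ℂ)} {u : Fin n → ℝ}
    (hlag : ∀ i j, (herm p (jac F u i) (jac F u j)).im = 0) (hdet : jacDet F u ≠ 0) :
    (inducedMetric p F u).det ≠ 0 := by
  have h : (inducedMetric p F u).det = (∏ j : Fin n, sgn p j) * Complex.normSq (jacDet F u) :=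
    det_metric_gram p hlag
  rw [h]
  refine mul_ne_zero ?_ (by simpa using hdet)
  rcases prod_sgn_eq (n := n) p with h | h <;> rw [h] <;> norm_num

/-- Minimality of the evolving map, split into the equations in the directions of `s` and of the
tangent spaces of the quadric. -/
theorem isMinimal_evolvingMap_iff {n p : ℕ} {M : Matrix (Fin n) (Fin n) ℝ} (hM : IsUnit M)
    (hsa : ∀ x y : Fin n → ℝ, realForm p (M *ᵥ x) y = realForm p x (M *ᵥ y))
    {c : ℝ} (hS : QuadricNondegenerate p M c) {J : Set ℝ} (hJo : IsOpen J)
    {r : ℝ → ℝ} (hr : ContDiffOn ℝ ∞ r J) (hrpos : ∀ s ∈ J, 0 < r s) :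
    IsMinimal p (J ×ˢ quadric p M c) (evolvingMap M r) ↔ ∀ s ∈ J, ∀ x ∈ quadric p M c,
      M.trace * ((deriv r s / r s * c) ^ 2 + realForm p (M *ᵥ x) (M *ᵥ x) ^ 2) =
          c * realForm p (M *ᵥ x) (M *ᵥ x) * deriv (fun s => deriv r s / r s) s ∧
        ∀ w, realForm p w (M *ᵥ x) = 0 →
          c * (deriv r s / r s) * realForm p (M *ᵥ w) (M *ᵥ x) = 0 := by
  constructor
  · intro hmin s hs x hx
    obtain ⟨U, ψ, hψ, u, hu, hux, ⟨v, hv⟩, hw⟩ := exists_isLocalParametrization hM hsa hS hJo hs hx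
    have hcrit := (isVolumeCritical_evolvingMap_comp_iff hM hsa hS hJo hr hrpos hψ).1
      (hmin U ψ hψ).2 u hu
    simp only [hux] at hcrit
    constructor
    · have := hcrit v
      rw [hv] at this
      simp only [Matrix.mulVec_zero, realForm_zero_left] at this
      linear_combination this
    · intro w hwx
      obtain ⟨v, hv⟩ := hw w hwx
      have := hcrit v
      rw [hv] at this
      simp only at this
      linear_combination this / 2
  · intro h U ψ hψ
    refine ⟨fun u hu => det_inducedMetric_ne_zero (fun i j =>
      im_herm_fderiv_evolvingMap_comp hsa hJo hr hrpos hψ hu _ _)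
      (jacDet_evolvingMap_comp_ne_zero hM hsa hS hJo hr hrpos hψ hu), ?_⟩
    refine (isVolumeCritical_evolvingMap_comp_iff hM hsa hS hJo hr hrpos hψ).2 fun u hu v => ?_
    obtain ⟨h1, h2⟩ := h _ (hψ.mapsTo hu).1 _ (hψ.mapsTo hu).2
    have h3 := h2 _ (realForm_fderiv_snd hsa hψ hu v)
    linear_combination (fderiv ℝ ψ u v).1 * h1 + 2 * h3

theorem isLagrangianImmersion_evolvingMap {n p : ℕ} {M : Matrix (Fin n) (Fin n) ℝ} (hM : IsUnit M)
    (hsa : ∀ x y : Fin n → ℝ, realForm p (M *ᵥ x) y = realForm p x (M *ᵥ y))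
    {c : ℝ} {J : Set ℝ} (hJo : IsOpen J)
    {r : ℝ → ℝ} (hr : ContDiffOn ℝ ∞ r J) (hrpos : ∀ s ∈ J, 0 < r s) :
    IsLagrangianImmersion p (J ×ˢ quadric p M c) (evolvingMap M r) := fun _ _ hψ =>
  ⟨contDiffOn_evolvingMap_comp hr hψ, fun _ hu =>
    ⟨injective_fderiv_evolvingMap_comp hM hJo hr hrpos hψ hu, fun v w => by
      rw [symplecticForm, im_herm_fderiv_evolvingMap_comp hsa hJo hr hrpos hψ hu, neg_zero]⟩⟩

/-! ### Evolving maps contained in a Lagrangian catenoid -/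

/-- On the Lagrangian catenoid, the argument of the complex Jacobian determinant is constant. Write
`g = γ x` locally; then `det(∂_i g) = γⁿ det(∂_i x + (∂_i γ / γ) x)` is linear in `∂_i γ / γ`,
because the vectors `∂_i x` are orthogonal to `x`, and `γⁿ ∂_i γ / γ = ∂_i(γⁿ) / n` is real. -/
theorem im_jacDet_eq_zero_of_mapsTo_lagrangianCatenoid {n p : ℕ} {ε C : ℝ} (hε : ε ≠ 0)
    (hC : C ≠ 0) {U : Set (Fin n → ℝ)} (hU : IsOpen U) {g : (Fin n → ℝ) → (Fin n → ℂ)}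
    (hg : ContDiffOn ℝ ∞ g U) (hgU : ∀ u ∈ U, g u ∈ lagrangianCatenoid n p ε C)
    {u : Fin n → ℝ} (hu : u ∈ U) : (jacDet g u).im = 0 := by
  obtain ⟨γ₀, x₀, hx₀, hγ₀C, hgu⟩ := hgU u hu
  have hγpow : γ₀ ^ n ≠ 0 := fun h => hC (by rw [← hγ₀C, h]; rfl)
  have hn : n ≠ 0 := by
    rintro rfl
    exact hC (by rw [← hγ₀C]; simp)
  have hγ₀ : γ₀ ≠ 0 := fun h => hγpow (by rw [h, zero_pow hn])
  have hεC : (ε : ℂ) ≠ 0 := by exact_mod_cast hε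
  have hquad : ∀ (γ : ℂ) (x : Fin n → ℝ), realForm p x x = ε →
      ∑ j, (sgn p j : ℂ) * ((γ • fun j => (x j : ℂ)) j) ^ 2 = γ ^ 2 * ε := by
    intro γ x hx
    rw [← hx, realForm, Complex.ofReal_sum, Finset.mul_sum]
    refine Finset.sum_congr rfl fun j _ => ?_
    simp only [Pi.smul_apply, smul_eq_mul]
    push_cast
    ring
  have hrow : ∀ v : Fin n → ℝ, ∃ (b : Fin n → ℝ) (τ : ℂ), realForm p b x₀ = 0 ∧
      (γ₀ ^ n * τ).im = 0 ∧ fderiv ℝ g u v = γ₀ • (toComplex b 0 + τ • toComplex x₀ 0) := by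
    intro v
    have hgd : HasDerivAt (fun t : ℝ => g (u + t • v)) (fderiv ℝ g u v) 0 :=
      hasDerivAt_line ((hg.differentiableOn (by simp)).differentiableAt (hU.mem_nhds hu)) v
    -- the local square root `γ` of `ε q(g)`, where `q` is the complex quadratic form
    set q : ℝ → ℂ := fun t => ∑ j, (sgn p j : ℂ) * (g (u + t • v) j) ^ 2 with hq
    have hq0 : q 0 = γ₀ ^ 2 * ε := by
      simp only [hq, zero_smul, add_zero]
      rw [hgu]
      exact hquad γ₀ x₀ hx₀
    have hq0' : q 0 ≠ 0 := by rw [hq0]; exact mul_ne_zero (pow_ne_zero 2 hγ₀) hεC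
    have hqd : DifferentiableAt ℝ q 0 := by
      refine DifferentiableAt.fun_sum fun j _ => ?_
      exact ((hasDerivAt_pi.1 hgd j).differentiableAt.pow 2).const_mul _
    set γ : ℝ → ℂ := fun t => γ₀ * Complex.exp (Complex.log (q t / q 0) / 2) with hγ
    have hγd : DifferentiableAt ℝ γ 0 := by
      have h1 : HasDerivAt (fun t => q t / q 0) (deriv q 0 / q 0) 0 := hqd.hasDerivAt.div_const _
      have h2 := h1.clog_real (by rw [div_self hq0']; exact Complex.one_mem_slitPlane)
      exact ((h2.differentiableAt.div_const 2).cexp).const_mul γ₀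
    have hγ0 : γ 0 = γ₀ := by simp [hγ, hq0']
    have hev : ∀ᶠ t : ℝ in nhds 0, ∃ x : Fin n → ℝ, realForm p x x = ε ∧
        ((γ t) ^ n).im ^ 2 = C ^ 2 ∧ g (u + t • v) = γ t • fun j => (x j : ℂ) := by
      filter_upwards [eventually_line_mem hU hu v, hqd.continuousAt.eventually_ne hq0']
        with t ht hqt
      obtain ⟨δ, x, hx, hδC, hgt⟩ := hgU _ ht
      have h1 : q t = δ ^ 2 * ε := by
        simp only [hq]
        rw [hgt]
        exact hquad δ x hx
      have h2 : γ t ^ 2 = δ ^ 2 := by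
        simp only [hγ]
        rw [mul_pow, ← Complex.exp_nat_mul]
        rw [show ((2 : ℕ) : ℂ) * (Complex.log (q t / q 0) / 2) = Complex.log (q t / q 0) by
          push_cast; ring, Complex.exp_log (div_ne_zero hqt hq0'), hq0, h1]
        field_simp
      rcases sq_eq_sq_iff_eq_or_eq_neg.1 h2 with h | h
      · exact ⟨x, hx, by rw [h, hδC], by rw [h]; exact hgt⟩
      · refine ⟨-x, ?_, ?_, ?_⟩
        · rw [← neg_one_smul ℝ x, realForm_smul_left, realForm_smul_right, hx]; ring
        · rw [h, neg_pow, ← hδC]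
          rcases neg_one_pow_eq_or ℂ n with h' | h' <;> rw [h'] <;> simp
        · rw [h, hgt]; ext j; simp
    have hγne : ∀ᶠ t : ℝ in nhds 0, γ t ≠ 0 :=
      hγd.continuousAt.eventually_ne (by rw [hγ0]; exact hγ₀)
    set γ' := deriv γ 0 with hγ'
    have hγd' : HasDerivAt γ γ' 0 := hγd.hasDerivAt
    -- `x = g / γ` is real
    set X : ℝ → Fin n → ℝ := fun t j => (g (u + t • v) j / γ t).re with hX
    set b : Fin n → ℝ := deriv X 0 with hb
    have hXx : ∀ᶠ t : ℝ in nhds 0, realForm p (X t) (X t) = ε ∧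
        g (u + t • v) = γ t • toComplex (X t) 0 := by
      filter_upwards [hev, hγne] with t ht h0
      obtain ⟨x, hx, -, hgt⟩ := ht
      have : X t = x := by
        ext j
        simp only [hX, hgt, Pi.smul_apply, smul_eq_mul]
        rw [mul_div_cancel_left₀ _ h0, Complex.ofReal_re]
      rw [this]
      refine ⟨hx, ?_⟩
      rw [hgt]
      ext j
      simp [toComplex]
    have hXd : HasDerivAt X b 0 := by
      refine DifferentiableAt.hasDerivAt (differentiableAt_pi.2 fun j => ?_)
      have hγ0' : γ 0 ≠ 0 := by rw [hγ0]; exact hγ₀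
      exact (hasDerivAt_re ((hasDerivAt_pi.1 hgd j).div hγd' hγ0')).differentiableAt
    have hX0 : X 0 = x₀ := by
      ext j
      simp only [hX, zero_smul, add_zero, hgu, hγ0, Pi.smul_apply, smul_eq_mul]
      rw [mul_div_cancel_left₀ _ hγ₀, Complex.ofReal_re]
    refine ⟨b, γ' / γ₀, ?_, ?_, ?_⟩
    · have h1 := hasDerivAt_realForm (p := p) hXd hXd
      have h2 := h1.unique ((hasDerivAt_const (0 : ℝ) ε).congr_of_eventuallyEq
        (hXx.mono fun t ht => ht.1))
      rw [realForm_comm p (X 0) b, hX0] at h2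
      linarith
    · have h1 : HasDerivAt (fun t => ((γ t) ^ n).im) ((n : ℂ) * γ 0 ^ (n - 1) * γ').im 0 :=
        Complex.imCLM.hasFDerivAt.comp_hasDerivAt (0 : ℝ) (hγd'.pow n)
      have h2 := (h1.pow 2).unique ((hasDerivAt_const (0 : ℝ) (C ^ 2)).congr_of_eventuallyEq
        (hev.mono fun t ht => by obtain ⟨x, -, h, -⟩ := ht; exact h))
      rw [hγ0, hγ₀C] at h2
      have h3 : ((n : ℂ) * γ₀ ^ (n - 1) * γ').im = 0 := by simpa [hC] using h2
      have h4 : (n : ℂ) * γ₀ ^ (n - 1) * γ' = ((n : ℝ) : ℂ) * (γ₀ ^ n * (γ' / γ₀)) := by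
        rw [← pow_sub_one_mul hn γ₀]
        push_cast
        field_simp
      rw [h4, Complex.im_ofReal_mul] at h3
      exact (mul_eq_zero.1 h3).resolve_left (by exact_mod_cast hn)
    · ext j
      have h1 : HasDerivAt (fun t => γ t * (X t j : ℂ)) (γ' * (X 0 j : ℂ) + γ 0 * (b j : ℂ)) 0 :=
        hγd'.mul (hasDerivAt_pi.1 hXd j).ofReal_comp
      have h2 := (hasDerivAt_pi.1 hgd j).unique (h1.congr_of_eventuallyEq
        (hXx.mono fun t ht => by
          have := congrFun ht.2 j
          simpa [toComplex] using this))
      rw [h2, hX0, hγ0]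
      simp only [toComplex, Pi.smul_apply, Pi.add_apply, smul_eq_mul, Pi.zero_apply]
      push_cast
      field_simp
      ring
  choose b τ hb hτ hd using hrow
  have hjac : jac g u = γ₀ • (Matrix.of fun i => toComplex (b (Pi.single i 1)) 0 +
      τ (Pi.single i 1) • toComplex x₀ 0) := by
    ext i j
    exact congrFun (hd (Pi.single i 1)) j
  have hscale := det_of_add_smul (b := fun i => toComplex (b (Pi.single i 1)) 0)
    (τ := fun i => τ (Pi.single i 1)) (m := toComplex x₀ 0)
    (w := fun k => ((sgn p k * x₀ k / realForm p x₀ x₀ : ℝ) : ℂ))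
    (fun i => by rw [toComplex_zero_dotProduct, hb]; simp)
    (by rw [toComplex_zero_dotProduct, div_self (by rw [hx₀]; exact hε)]; simp)
    (γ₀ ^ n • toComplex x₀ 0)
  rw [smul_dotProduct, toComplex_zero_dotProduct, div_self (by rw [hx₀]; exact hε)] at hscale
  have hreal : (Matrix.of fun i => toComplex (b (Pi.single i 1)) 0 +
      τ (Pi.single i 1) • γ₀ ^ n • toComplex x₀ 0) =
      (Matrix.of fun i => b (Pi.single i 1) +
        (γ₀ ^ n * τ (Pi.single i 1)).re • x₀).map (fun a : ℝ => (a : ℂ)) := by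
    ext i j
    have : ((γ₀ ^ n * τ (Pi.single i 1)).re : ℂ) = γ₀ ^ n * τ (Pi.single i 1) :=
      Complex.ext (by simp) (by rw [hτ]; simp)
    simp only [Matrix.of_apply, Matrix.map_apply, toComplex, Pi.add_apply, Pi.smul_apply,
      smul_eq_mul, Pi.zero_apply]
    push_cast
    rw [this]
    ring
  rw [hreal, det_map_ofReal] at hscale
  rw [jacDet, hjac, Matrix.det_smul, Fintype.card_fin, mul_comm]
  simp only [Complex.ofReal_one, smul_eq_mul, mul_one] at hscale
  rw [← hscale, Complex.ofReal_im]

theorem injective_of_herm_eq {n p : ℕ} {A : (Fin n → ℂ) →ₗ[ℂ] (Fin n → ℂ)}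
    (hA : ∀ z w, herm p (A z) (A w) = herm p z w) : Function.Injective A := by
  refine (injective_iff_map_eq_zero A).2 fun z hz => ?_
  ext j
  have h1 := hA z (Pi.single j 1)
  rw [hz] at h1
  have h2 : herm p z (Pi.single j 1) = (sgn p j : ℂ) * z j := by
    rw [herm, Finset.sum_eq_single j (by intro b _ hb; simp [hb]) (by simp)]
    simp
  have h3 : herm p 0 (A (Pi.single j 1)) = 0 := by simp [herm]
  rw [h2, h3] at h1
  exact (mul_eq_zero.1 h1.symm).resolve_left (by exact_mod_cast sgn_ne_zero p j)

/-- In the coordinates of the catenoid the complex Jacobian determinant is real, and the congruence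
multiplies it by the constant determinant of a complex linear map. The Lagrangian angle is therefore
constant. -/
theorem isMinimal_of_isPartOfLagrangianCatenoid {n p : ℕ} {M : Matrix (Fin n) (Fin n) ℝ}
    (hM : IsUnit M)
    (hsa : ∀ x y : Fin n → ℝ, realForm p (M *ᵥ x) y = realForm p x (M *ᵥ y))
    {c : ℝ} (hS : QuadricNondegenerate p M c) {J : Set ℝ} (hJo : IsOpen J)
    {r : ℝ → ℝ} (hr : ContDiffOn ℝ ∞ r J) (hrpos : ∀ s ∈ J, 0 < r s)
    (h : IsPartOfLagrangianCatenoid p (evolvingMap M r '' (J ×ˢ quadric p M c))) :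
    IsMinimal p (J ×ˢ quadric p M c) (evolvingMap M r) := by
  obtain ⟨ε, C, hε, hC, A, b, hA, hL⟩ := h
  have hε0 : ε ≠ 0 := by rcases hε with h | h <;> rw [h] <;> norm_num
  intro U ψ hψ
  have hlag : ∀ u ∈ U, ∀ i j, (herm p (jac (evolvingMap M r ∘ ψ) u i)
      (jac (evolvingMap M r ∘ ψ) u j)).im = 0 := fun u hu i j =>
    im_herm_fderiv_evolvingMap_comp hsa hJo hr hrpos hψ hu _ _
  have hdet : ∀ u ∈ U, jacDet (evolvingMap M r ∘ ψ) u ≠ 0 := fun u hu =>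
    jacDet_evolvingMap_comp_ne_zero hM hsa hS hJo hr hrpos hψ hu
  have hF := contDiffOn_evolvingMap_comp hr hψ
  refine ⟨fun u hu => det_inducedMetric_ne_zero (hlag u hu) (hdet u hu),
    (isVolumeCritical_iff hψ.isOpen hF hlag hdet).2 fun u hu v => ?_⟩
  set F := evolvingMap M r ∘ ψ with hFdef
  set e : (Fin n → ℂ) ≃ₗ[ℂ] (Fin n → ℂ) := LinearEquiv.ofInjectiveEndo A (injective_of_herm_eq hA)
    with he
  have heA : ∀ z, e.symm (A z) = z := fun z => by
    have : A z = e z := rfl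
    rw [this, e.symm_apply_apply]
  set T : (Fin n → ℂ) →L[ℝ] (Fin n → ℂ) :=
    (LinearMap.toContinuousLinearMap (e.symm : (Fin n → ℂ) →ₗ[ℂ] (Fin n → ℂ))).restrictScalars ℝ
    with hT
  set g : (Fin n → ℝ) → (Fin n → ℂ) := fun u => T (F u - b) with hg
  have hgs : ContDiffOn ℝ ∞ g U := T.contDiff.comp_contDiffOn (hF.sub contDiffOn_const)
  have hgU : ∀ u ∈ U, g u ∈ lagrangianCatenoid n p ε C := by
    intro u hu
    obtain ⟨z, hz, hzF⟩ := hL ⟨ψ u, hψ.mapsTo hu, rfl⟩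
    have : g u = z := by
      simp only [hg]
      rw [show F u = A z + b from hzF.symm, add_sub_cancel_right]
      exact heA z
    rwa [this]
  set κ : ℂ := (LinearMap.toMatrix' (e.symm : (Fin n → ℂ) →ₗ[ℂ] (Fin n → ℂ))).det with hκ
  have hκ0 : κ ≠ 0 := by
    rw [hκ, LinearMap.det_toMatrix']
    exact (LinearEquiv.isUnit_det' e.symm).ne_zero
  have hjac : ∀ y ∈ U, jacDet g y = jacDet F y * κ := by
    intro y hy
    have hFd : DifferentiableAt ℝ F y :=
      (hF.differentiableOn (by simp)).differentiableAt (hψ.isOpen.mem_nhds hy)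
    have h1 : ∀ w, fderiv ℝ g y w = T (fderiv ℝ F y w) := by
      intro w
      have h2 : HasFDerivAt g (T.comp (fderiv ℝ F y)) y :=
        T.hasFDerivAt.comp y (hFd.hasFDerivAt.sub_const b)
      rw [h2.fderiv]
      rfl
    have h2 : jac g y = jac F y *
        (LinearMap.toMatrix' (e.symm : (Fin n → ℂ) →ₗ[ℂ] (Fin n → ℂ)))ᵀ := by
      ext i j
      have h3 : jac g y i = LinearMap.toMatrix' (e.symm : (Fin n → ℂ) →ₗ[ℂ] (Fin n → ℂ)) *ᵥ
          fderiv ℝ F y (Pi.single i 1) := by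
        rw [LinearMap.toMatrix'_mulVec]
        exact h1 _
      rw [h3, Matrix.mul_apply]
      simp only [Matrix.mulVec, dotProduct, Matrix.transpose_apply]
      exact Finset.sum_congr rfl fun k _ => mul_comm _ _
    rw [jacDet, h2, Matrix.det_mul, Matrix.det_transpose, jacDet, hκ]
  have hDd := hasDerivAt_line (((contDiffOn_jacDet hψ.isOpen hF).differentiableOn
    (by simp)).differentiableAt (hψ.isOpen.mem_nhds hu)) v
  have hreal : ∀ y ∈ U, (jacDet F y * κ).im = 0 := fun y hy => by
    rw [← hjac y hy]
    exact im_jacDet_eq_zero_of_mapsTo_lagrangianCatenoid hε0 hC hψ.isOpen hgs hgU hy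
  have hev := eventually_line_mem hψ.isOpen hu v
  have h1 : (fderiv ℝ (jacDet F) u v * κ).im = 0 :=
    hasDerivAt_im_eq_zero (hDd.mul_const κ) (hev.mono fun t ht => hreal _ ht)
  have h2 := hreal u hu
  have h3 : Complex.normSq κ * ((starRingEnd ℂ) (jacDet F u) * fderiv ℝ (jacDet F) u v).im =
      ((starRingEnd ℂ) (jacDet F u * κ) * (fderiv ℝ (jacDet F) u v * κ)).im := by
    rw [← Complex.im_ofReal_mul, Complex.normSq_eq_conj_mul_self, map_mul]
    congr 1
    ring
  rw [Complex.mul_im ((starRingEnd ℂ) (jacDet F u * κ)), Complex.conj_im, h1, h2, neg_zero,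
    zero_mul, mul_zero, add_zero] at h3
  exact (mul_eq_zero.1 h3).resolve_left (Complex.normSq_pos.2 hκ0).ne'

/-! ### Solving the minimality equations -/

/-- If every vector of the open cone `c ⟨x, M x⟩ > 0` is an eigenvector of `M`, then `M` is a
multiple of the identity: the equations `(M x)_i x_j = (M x)_j x_i` are quadratic in `x`, so that they
hold everywhere as soon as they hold on a non-empty open set. -/
theorem eq_smul_one_of_eigenvectors {n p : ℕ} {M : Matrix (Fin n) (Fin n) ℝ} {c : ℝ} (hc : c ≠ 0)
    {x₀ : Fin n → ℝ} (hx₀ : x₀ ∈ quadric p M c)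
    (h : ∀ x ∈ quadric p M c, ∃ κ : ℝ, M *ᵥ x = κ • x) :
    ∃ κ : ℝ, M = κ • (1 : Matrix (Fin n) (Fin n) ℝ) := by
  have hcone : ∀ x, 0 < c * realForm p x (M *ᵥ x) → ∃ κ : ℝ, M *ᵥ x = κ • x := by
    intro x hx
    set q := realForm p x (M *ᵥ x) with hq
    have hq0 : q ≠ 0 := fun h => by rw [h, mul_zero] at hx; exact lt_irrefl _ hx
    have hcq : 0 < c / q := by
      rw [show c / q = c * q / q ^ 2 by field_simp]
      positivity
    set t := Real.sqrt (c / q) with ht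
    have ht0 : t ≠ 0 := (Real.sqrt_pos.2 hcq).ne'
    have ht2 : t ^ 2 = c / q := Real.sq_sqrt hcq.le
    have hmem : t • x ∈ quadric p M c := by
      refine ⟨?_, smul_ne_zero ht0 fun h0 => hq0 (by rw [hq, h0, realForm_zero_left])⟩
      rw [Matrix.mulVec_smul, realForm_smul_left, realForm_smul_right, ← mul_assoc, ← sq, ht2, ← hq,
        div_mul_cancel₀ _ hq0]
    obtain ⟨κ, hκ⟩ := h _ hmem
    refine ⟨κ, smul_right_injective _ ht0 ?_⟩
    simp only [← Matrix.mulVec_smul, hκ, smul_comm t κ x]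
  have hpol : ∀ (y : Fin n → ℝ) (i j : Fin n), (M *ᵥ y) i * y j = (M *ᵥ y) j * y i := by
    intro y i j
    have hcont : Continuous fun t : ℝ => c * realForm p (x₀ + t • y) (M *ᵥ (x₀ + t • y)) := by
      refine continuous_const.mul (ContDiff.continuous (𝕜 := ℝ) (n := ∞) ?_)
      have h1 : ContDiff ℝ ∞ fun t : ℝ => x₀ + t • y :=
        contDiff_const.add (contDiff_id.smul contDiff_const)
      exact contDiff_realForm p h1 ((LinearMap.toContinuousLinearMap M.mulVecLin).contDiff.comp h1)
    have hpos : ∀ᶠ t : ℝ in nhds 0, 0 < c * realForm p (x₀ + t • y) (M *ᵥ (x₀ + t • y)) := by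
      refine hcont.continuousAt.eventually (lt_mem_nhds ?_)
      simp only [zero_smul, add_zero, hx₀.1]
      exact mul_self_pos.2 hc
    obtain ⟨ε, hε, hball⟩ := Metric.eventually_nhds_iff.1 hpos
    have hq : ∀ t : ℝ, |t| < ε → (M *ᵥ (x₀ + t • y)) i * (x₀ + t • y) j =
        (M *ᵥ (x₀ + t • y)) j * (x₀ + t • y) i := by
      intro t ht
      obtain ⟨κ, hκ⟩ := hcone _ (hball (by simpa using ht))
      rw [hκ]
      simp only [Pi.smul_apply, smul_eq_mul]
      ring
    -- The second difference in `t` isolates the coefficient of `t²`.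
    have h0 := hq 0 (by simpa using hε)
    have h1 := hq (ε / 2) (by rw [abs_of_pos (by positivity)]; linarith)
    have h2 := hq (-(ε / 2)) (by rw [abs_neg, abs_of_pos (by positivity)]; linarith)
    simp only [Matrix.mulVec_add, Matrix.mulVec_smul, Pi.add_apply, Pi.smul_apply, smul_eq_mul,
      zero_mul, add_zero] at h0 h1 h2
    have hε2 : 2 * (ε / 2) ^ 2 ≠ 0 := by positivity
    refine mul_left_cancel₀ hε2 ?_
    linear_combination h1 + h2 - 2 * h0
  obtain ⟨j₀, -⟩ : ∃ j, x₀ j ≠ 0 := Function.ne_iff.1 hx₀.2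
  have hoff : ∀ i k, i ≠ k → M i k = 0 := by
    intro i k hik
    have := hpol (Pi.single k 1) i k
    simpa [Matrix.mulVec_single_one, hik] using this
  have hdiag : ∀ i, M i i = M j₀ j₀ := by
    intro i
    by_cases hij : i = j₀
    · rw [hij]
    · have := hpol (Pi.single i 1 + Pi.single j₀ 1) i j₀
      simpa [Matrix.mulVec_add, Matrix.mulVec_single_one, hij, Ne.symm hij, hoff i j₀ hij,
        hoff j₀ i (Ne.symm hij)] using this
  refine ⟨M j₀ j₀, ?_⟩
  ext i k
  by_cases hik : i = k
  · subst hik; simp [hdiag]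
  · simp [hik, hoff]

/-- If `M` maps the orthogonal complement of `M x` into itself, then `M x` is an eigenvector of `M`,
and so is `x`, as `M` is injective. -/
theorem exists_mulVec_eq_smul {n p : ℕ} {M : Matrix (Fin n) (Fin n) ℝ} (hM : IsUnit M)
    (hsa : ∀ x y : Fin n → ℝ, realForm p (M *ᵥ x) y = realForm p x (M *ᵥ y))
    {x : Fin n → ℝ} (hμ : realForm p (M *ᵥ x) (M *ᵥ x) ≠ 0)
    (h : ∀ w, realForm p w (M *ᵥ x) = 0 → realForm p (M *ᵥ w) (M *ᵥ x) = 0) :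
    ∃ κ : ℝ, M *ᵥ x = κ • x := by
  set m := M *ᵥ x with hm
  refine ⟨realForm p m (M *ᵥ m) / realForm p m m, ?_⟩
  set κ := realForm p m (M *ᵥ m) / realForm p m m with hκ
  have h1 : M *ᵥ (m - κ • x) = 0 := by
    refine eq_zero_of_realForm_eq_zero p fun y => ?_
    have hy : y = orthProj p m y + (realForm p y m / realForm p m m) • m := by
      simp [orthProj]
    have h2 := h _ (realForm_orthProj hμ y)
    rw [hsa] at h2
    have h3 := realForm_orthProj hμ y
    rw [realForm_comm, Matrix.mulVec_sub, Matrix.mulVec_smul, ← hm, realForm_comm,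
      realForm_sub_left, realForm_smul_left, realForm_comm p (M *ᵥ m), realForm_comm p m, hy,
      realForm_add_left, realForm_add_left, realForm_smul_left, realForm_smul_left, h2, h3, hκ]
    field_simp
    ring
  exact sub_eq_zero.1
    (Matrix.eq_zero_of_mulVec_eq_zero ((Matrix.isUnit_iff_isUnit_det _).1 hM).ne_zero h1)

theorem expI_smul_one {n : ℕ} (κ s : ℝ) :
    expI (κ • (1 : Matrix (Fin n) (Fin n) ℝ)) s = Complex.exp (Complex.I * s * κ) • 1 := by
  have h : (Complex.I * (s : ℂ)) • (κ • (1 : Matrix (Fin n) (Fin n) ℝ)).map (fun a : ℝ => (a : ℂ)) =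
      Matrix.diagonal fun _ => Complex.I * s * κ := by
    ext i j
    by_cases hij : i = j
    · subst hij; simp [mul_assoc]
    · simp [hij]
  rw [expI, h, Matrix.exp_diagonal]
  ext i j
  by_cases hij : i = j
  · subst hij
    simp [Complex.exp_eq_exp_ℂ, Pi.coe_exp]
  · simp [hij]

/-- The case of a multiple of the identity: with `ρ = r' / r` and `γ = r e^{iκs}`, the equation
`ρ' = n (ρ² + κ²)` says that `(ρ + iκ) / conj(γ)ⁿ` is a constant `P₀`, and then `Im (γⁿ / P₀)` is a
non-zero constant. -/
theorem exists_im_pow_eq_const {n : ℕ} {κ : ℝ} (hκ : κ ≠ 0) {J : Set ℝ} (hJo : IsOpen J)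
    (hJc : J.OrdConnected) (hJn : J.Nonempty) {r : ℝ → ℝ} (hr : ContDiffOn ℝ ∞ r J)
    (hrpos : ∀ s ∈ J, 0 < r s)
    (hode : ∀ s ∈ J, deriv (fun s => deriv r s / r s) s = n * ((deriv r s / r s) ^ 2 + κ ^ 2)) :
    ∃ (P : ℂ) (C : ℝ), P ≠ 0 ∧ C ≠ 0 ∧
      ∀ s ∈ J, (((r s : ℂ) * Complex.exp (Complex.I * s * κ)) ^ n / P).im = C := by
  set ρ : ℝ → ℝ := fun s => deriv r s / r s with hρdef
  set γ : ℝ → ℂ := fun s => (r s : ℂ) * Complex.exp (Complex.I * s * κ) with hγdef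
  have hr0 : ∀ s ∈ J, (r s : ℂ) ≠ 0 := fun s hs => by exact_mod_cast (hrpos s hs).ne'
  have hγ0 : ∀ s ∈ J, γ s ≠ 0 := fun s hs => mul_ne_zero (hr0 s hs) (Complex.exp_ne_zero _)
  have hγd : ∀ s ∈ J, HasDerivAt γ (((ρ s : ℂ) + Complex.I * κ) * γ s) s := by
    intro s hs
    have h1 : HasDerivAt (fun s => (r s : ℂ)) ((deriv r s : ℝ) : ℂ) s :=
      ((hr.differentiableOn (by simp)).differentiableAt (hJo.mem_nhds hs)).hasDerivAt.ofReal_comp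
    have h2 : HasDerivAt (fun s : ℝ => Complex.I * (s : ℂ) * κ) (Complex.I * κ) s := by
      have := ((hasDerivAt_id s).ofReal_comp.const_mul Complex.I).mul_const (κ : ℂ)
      simpa using this
    have h3 := h1.mul ((Complex.hasDerivAt_exp _).comp s h2)
    refine h3.congr_deriv ?_
    simp only [hγdef, hρdef, Function.comp_apply]
    push_cast
    field_simp [hr0 s hs]
  have hρd : ∀ s ∈ J, HasDerivAt ρ (n * (ρ s ^ 2 + κ ^ 2)) s := by
    intro s hs
    have h1 : ContDiffOn ℝ ∞ (deriv r) J := hr.deriv_of_isOpen hJo (by simp)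
    have h2 := (h1.div hr fun s hs => (hrpos s hs).ne').differentiableOn (by simp)
    have h3 : HasDerivAt ρ _ s := (h2.differentiableAt (hJo.mem_nhds hs)).hasDerivAt
    exact h3.congr_deriv (hode s hs)
  have hpow : ∀ s ∈ J, HasDerivAt (fun s => γ s ^ n)
      (n * ((ρ s : ℂ) + Complex.I * κ) * γ s ^ n) s := by
    intro s hs
    refine ((hγd s hs).pow n).congr_deriv ?_
    rcases Nat.eq_zero_or_pos n with h | h
    · simp [h]
    · rw [← pow_sub_one_mul h.ne' (γ s)]; ring
  set W : ℝ → ℂ := fun s => ((ρ s : ℂ) + Complex.I * κ) / (starRingEnd ℂ) (γ s ^ n) with hW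
  have hconj0 : ∀ s ∈ J, (starRingEnd ℂ) (γ s ^ n) ≠ 0 := fun s hs =>
    (map_ne_zero _).2 (pow_ne_zero n (hγ0 s hs))
  have hWd : ∀ s ∈ J, HasDerivAt W 0 s := by
    intro s hs
    refine (((hρd s hs).ofReal_comp.add_const (Complex.I * κ)).div (hpow s hs).star
      (hconj0 s hs)).congr_deriv ?_
    rw [div_eq_zero_iff]
    left
    simp only [RCLike.star_def, map_mul, map_add, Complex.conj_ofReal, Complex.conj_I, map_natCast]
    push_cast
    linear_combination (n * κ ^ 2 * (starRingEnd ℂ) (γ s ^ n)) * (Complex.I_sq)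
  obtain ⟨s₁, hs₁⟩ := hJn
  have hpre : IsPreconnected J := hJc.isPreconnected
  have hWc : ∀ s ∈ J, W s = W s₁ := fun s hs =>
    hJo.is_const_of_deriv_eq_zero hpre
      (fun t ht => (hWd t ht).differentiableAt.differentiableWithinAt)
      (fun t ht => (hWd t ht).deriv) hs hs₁
  have hnum : ∀ s, (ρ s : ℂ) + Complex.I * κ ≠ 0 := fun s h => hκ (by
    simpa using congrArg Complex.im h)
  have hP0 : W s₁ ≠ 0 := div_ne_zero (hnum s₁) (hconj0 s₁ hs₁)
  have hval : ∀ s ∈ J, γ s ^ n / W s₁ = ((Complex.normSq (γ s ^ n) : ℝ) : ℂ) /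
      ((ρ s : ℂ) + Complex.I * κ) := by
    intro s hs
    rw [← hWc s hs, hW, Complex.normSq_eq_conj_mul_self, div_div_eq_mul_div, mul_comm]
  have hder : ∀ s ∈ J, HasDerivAt (fun s => (γ s ^ n / W s₁).im) 0 s := by
    intro s hs
    have h1 : HasDerivAt (fun s => (γ s ^ n / W s₁).im)
        (n * ((ρ s : ℂ) + Complex.I * κ) * γ s ^ n / W s₁).im s :=
      Complex.imCLM.hasFDerivAt.comp_hasDerivAt s ((hpow s hs).div_const _)
    refine h1.congr_deriv ?_
    rw [mul_div_assoc, hval s hs, mul_assoc, mul_div_cancel₀ _ (hnum s), ← Complex.ofReal_natCast,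
      ← Complex.ofReal_mul, Complex.ofReal_im]
  refine ⟨W s₁, (γ s₁ ^ n / W s₁).im, hP0, ?_, fun s hs => ?_⟩
  · have hN : Complex.normSq (γ s₁ ^ n) ≠ 0 :=
      (Complex.normSq_pos.2 (pow_ne_zero n (hγ0 s₁ hs₁))).ne'
    have hz := (Complex.normSq_pos.2 (hnum s₁)).ne'
    rw [hval s₁ hs₁, Complex.div_im, Complex.ofReal_im, zero_mul, zero_div, zero_sub,
      Complex.ofReal_re]
    refine neg_ne_zero.2 (div_ne_zero (mul_ne_zero hN ?_) hz)
    simpa using hκ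
  · exact hJo.is_const_of_deriv_eq_zero hpre
      (fun t ht => (hder t ht).differentiableAt.differentiableWithinAt)
      (fun t ht => (hder t ht).deriv) hs hs₁

theorem isPartOfLagrangianCatenoid_smul_one {n p : ℕ} {κ c : ℝ} (hκ : κ ≠ 0) (hc : c ≠ 0)
    (hn : n ≠ 0) {J : Set ℝ} {r : ℝ → ℝ} {P : ℂ} {C : ℝ} (hP : P ≠ 0) (hC : C ≠ 0)
    (h : ∀ s ∈ J, (((r s : ℂ) * Complex.exp (Complex.I * s * κ)) ^ n / P).im = C) :
    IsPartOfLagrangianCatenoid p (evolvingMap (κ • (1 : Matrix (Fin n) (Fin n) ℝ)) r ''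
      (J ×ˢ quadric p (κ • (1 : Matrix (Fin n) (Fin n) ℝ)) c)) := by
  set e : ℝ := c / κ with he
  have he0 : e ≠ 0 := div_ne_zero hc hκ
  set t : ℝ := Real.sqrt |e| with ht
  have ht0 : 0 < t := Real.sqrt_pos.2 (abs_pos.2 he0)
  have ht2 : t ^ 2 = |e| := Real.sq_sqrt (abs_nonneg e)
  have htC : (t : ℂ) ≠ 0 := by exact_mod_cast ht0.ne'
  have hn' : (n : ℂ) ≠ 0 := by exact_mod_cast hn
  -- an `n`-th root of `P / |P|`
  set ζ : ℂ := Complex.exp (((Complex.arg P / n : ℝ) : ℂ) * Complex.I) with hζ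
  have hζ1 : ‖ζ‖ = 1 := Complex.norm_exp_ofReal_mul_I _
  have hζ0 : ζ ≠ 0 := Complex.exp_ne_zero _
  have hζn : (‖P‖ : ℂ) * ζ ^ n = P := by
    rw [hζ, ← Complex.exp_nat_mul]
    rw [show (n : ℂ) * (((Complex.arg P / n : ℝ) : ℂ) * Complex.I) = Complex.arg P * Complex.I by
      push_cast; field_simp]
    exact Complex.norm_mul_exp_arg_mul_I P
  have hPn : ‖P‖ ≠ 0 := norm_ne_zero_iff.2 hP
  refine ⟨e / |e|, t ^ n * ‖P‖ * C, ?_, ?_, ζ • LinearMap.id, 0, ?_, ?_⟩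
  · rcases lt_or_gt_of_ne he0 with h | h
    · right; rw [abs_of_neg h, div_neg, div_self he0]
    · left; rw [abs_of_pos h, div_self he0]
  · exact mul_ne_zero (mul_ne_zero (pow_ne_zero n ht0.ne') hPn) hC
  · intro z w
    have hz : ζ * (starRingEnd ℂ) ζ = 1 := by
      rw [Complex.mul_conj, Complex.normSq_eq_norm_sq, hζ1]; simp
    simp only [herm, LinearMap.smul_apply, LinearMap.id_apply, Pi.smul_apply, smul_eq_mul, map_mul]
    refine Finset.sum_congr rfl fun j _ => ?_
    linear_combination ((sgn p j : ℂ) * z j * (starRingEnd ℂ) (w j)) * hz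
  · rintro _ ⟨⟨s, x⟩, ⟨hs, hx⟩, rfl⟩
    set γ : ℂ := (r s : ℂ) * Complex.exp (Complex.I * s * κ) with hγ
    refine ⟨(ζ⁻¹ * t * γ) • fun j => ((((t⁻¹ • x) j : ℝ)) : ℂ),
      ⟨ζ⁻¹ * t * γ, t⁻¹ • x, ?_, ?_, rfl⟩, ?_⟩
    · have hxx : realForm p x x = e := by
        have := hx.1
        rw [Matrix.smul_mulVec, Matrix.one_mulVec, realForm_smul_right] at this
        rw [he, ← this]; field_simp
      rw [realForm_smul_left, realForm_smul_right, hxx, ← ht2]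
      field_simp
    · have h1 : (ζ⁻¹ * t * γ) ^ n = ((t ^ n * ‖P‖ : ℝ) : ℂ) * (γ ^ n / P) := by
        have hPC : (‖P‖ : ℂ) ≠ 0 := by exact_mod_cast hPn
        rw [mul_pow, mul_pow, inv_pow]
        nth_rewrite 2 [← hζn]
        push_cast
        field_simp
      rw [h1, Complex.im_ofReal_mul, h s hs]
    · simp only [evolvingMap_apply, expI_smul_one, Matrix.smul_mulVec, Matrix.one_mulVec]
      ext j
      simp only [LinearMap.smul_apply, LinearMap.id_apply, Pi.smul_apply, smul_eq_mul, Pi.add_apply,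
        Pi.zero_apply, add_zero, hγ]
      push_cast
      field_simp

/-- The minimality equations at a single parameter `s₀` with `r'(s₀) ≠ 0` already make `M` a
multiple of the identity; the first equation on all of `J` then integrates to that of a catenoid. -/
theorem isPartOfLagrangianCatenoid_of_equations {n p : ℕ} {M : Matrix (Fin n) (Fin n) ℝ}
    (hM : IsUnit M)
    (hsa : ∀ x y : Fin n → ℝ, realForm p (M *ᵥ x) y = realForm p x (M *ᵥ y))
    {c : ℝ} (hc : c ≠ 0) (hS : QuadricNondegenerate p M c) {J : Set ℝ} (hJo : IsOpen J)
    (hJc : J.OrdConnected) {r : ℝ → ℝ} (hr : ContDiffOn ℝ ∞ r J) (hrpos : ∀ s ∈ J, 0 < r s)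
    {s₀ : ℝ} (hs₀ : s₀ ∈ J) (hr' : deriv r s₀ ≠ 0)
    (h : ∀ s ∈ J, ∀ x ∈ quadric p M c,
      M.trace * ((deriv r s / r s * c) ^ 2 + realForm p (M *ᵥ x) (M *ᵥ x) ^ 2) =
          c * realForm p (M *ᵥ x) (M *ᵥ x) * deriv (fun s => deriv r s / r s) s ∧
        ∀ w, realForm p w (M *ᵥ x) = 0 →
          c * (deriv r s / r s) * realForm p (M *ᵥ w) (M *ᵥ x) = 0) :
    IsPartOfLagrangianCatenoid p (evolvingMap M r '' (J ×ˢ quadric p M c)) := by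
  obtain ⟨x₀, hx₀⟩ := hS.1
  have hρ : c * (deriv r s₀ / r s₀) ≠ 0 := mul_ne_zero hc (div_ne_zero hr' (hrpos _ hs₀).ne')
  obtain ⟨κ, rfl⟩ := eq_smul_one_of_eigenvectors hc hx₀ fun x hx =>
    exists_mulVec_eq_smul hM hsa (realForm_mulVec_self_ne_zero hM hS hx) fun w hw =>
      (mul_eq_zero.1 ((h s₀ hs₀ x hx).2 w hw)).resolve_left hρ
  have hμ := realForm_mulVec_self_ne_zero hM hS hx₀
  have hxc := hx₀.1
  rw [Matrix.smul_mulVec, Matrix.one_mulVec, realForm_smul_right] at hxc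
  have hκ : κ ≠ 0 := fun h0 => hc (by rw [← hxc, h0, zero_mul])
  have hn : n ≠ 0 := by
    rintro rfl
    exact hx₀.2 (Subsingleton.elim _ _)
  obtain ⟨P, C, hP, hC, hPC⟩ := exists_im_pow_eq_const (n := n) hκ hJo hJc ⟨s₀, hs₀⟩ hr hrpos (by
    intro s hs
    have h1 := (h s hs x₀ hx₀).1
    rw [Matrix.smul_mulVec, Matrix.one_mulVec, realForm_smul_left, realForm_smul_right, hxc,
      Matrix.trace_smul, Matrix.trace_one, Fintype.card_fin, smul_eq_mul] at h1
    have h2 : κ * c ^ 2 ≠ 0 := mul_ne_zero hκ (pow_ne_zero 2 hc)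
    refine mul_left_cancel₀ h2 ?_
    linear_combination -h1)
  exact isPartOfLagrangianCatenoid_smul_one hκ hc hn hP hC hPC

end EvolvingQuadric

theorem mainTheorem6 {n p : ℕ} (hp : p ≤ n)
    (M : Matrix (Fin n) (Fin n) ℝ) (hM : IsUnit M)
    (hsa : ∀ x y : Fin n → ℝ,
      EvolvingQuadric.realForm p (M *ᵥ x) y = EvolvingQuadric.realForm p x (M *ᵥ y))
    (c : ℝ) (hS : EvolvingQuadric.QuadricNondegenerate p M c)
    (J : Set ℝ) (hJo : IsOpen J) (hJc : J.OrdConnected) (hJn : J.Nonempty)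
    (r : ℝ → ℝ) (hr : ContDiffOn ℝ ∞ r J) (hrpos : ∀ s ∈ J, 0 < r s) :
    EvolvingQuadric.IsLagrangianImmersion p (J ×ˢ EvolvingQuadric.quadric p M c)
        (EvolvingQuadric.evolvingMap M r) ∧
      (EvolvingQuadric.IsMinimal p (J ×ˢ EvolvingQuadric.quadric p M c)
          (EvolvingQuadric.evolvingMap M r) ↔
        (M.trace = 0 ∧ ∃ k : ℝ, ∀ s ∈ J, r s = k) ∨
        (M.trace = 0 ∧ c = 0) ∨
        EvolvingQuadric.IsPartOfLagrangianCatenoid p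
          (EvolvingQuadric.evolvingMap M r '' (J ×ˢ EvolvingQuadric.quadric p M c))) := by
  refine ⟨EvolvingQuadric.isLagrangianImmersion_evolvingMap hM hsa hJo hr hrpos, ?_, ?_⟩
  · intro hmin
    have h := (EvolvingQuadric.isMinimal_evolvingMap_iff hM hsa hS hJo hr hrpos).1 hmin
    obtain ⟨x, hx⟩ := hS.1
    obtain ⟨s, hs⟩ := hJn
    have hμ := EvolvingQuadric.realForm_mulVec_self_ne_zero hM hS hx
    by_cases hc : c = 0
    · subst hc
      have h1 := (h s hs x hx).1
      have : M.trace = 0 := by simpa [hμ] using h1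
      exact Or.inr (Or.inl ⟨this, rfl⟩)
    by_cases hr' : ∀ s ∈ J, deriv r s = 0
    · refine Or.inl ⟨?_, r s, fun t ht => hJo.is_const_of_deriv_eq_zero hJc.isPreconnected
        (hr.differentiableOn (by simp)) hr' ht hs⟩
      have h1 := (h s hs x hx).1
      have h2 : (fun s => deriv r s / r s) =ᶠ[nhds s] fun _ => 0 := by
        filter_upwards [hJo.mem_nhds hs] with t ht
        rw [hr' t ht, zero_div]
      rw [h2.deriv_eq, hr' s hs] at h1
      simpa [hμ] using h1
    · push Not at hr'
      obtain ⟨s₀, hs₀, hr'⟩ := hr'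
      exact Or.inr (Or.inr (EvolvingQuadric.isPartOfLagrangianCatenoid_of_equations hM hsa hc hS hJo
        hJc hr hrpos hs₀ hr' h))
  · rintro (⟨htr, k, hk⟩ | ⟨htr, rfl⟩ | h)
    · refine (EvolvingQuadric.isMinimal_evolvingMap_iff hM hsa hS hJo hr hrpos).2 fun s hs x _ => ?_
      have hr' : ∀ s ∈ J, deriv r s = 0 := by
        intro s hs
        have : r =ᶠ[nhds s] fun _ => k := by
          filter_upwards [hJo.mem_nhds hs] with t ht using hk t ht
        rw [this.deriv_eq, deriv_const]
      have h2 : (fun s => deriv r s / r s) =ᶠ[nhds s] fun _ => 0 := by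
        filter_upwards [hJo.mem_nhds hs] with t ht
        rw [hr' t ht, zero_div]
      rw [h2.deriv_eq, hr' s hs, htr]
      simp
    · refine (EvolvingQuadric.isMinimal_evolvingMap_iff hM hsa hS hJo hr hrpos).2 fun s hs x _ => ?_
      rw [htr]
      simp
    · exact EvolvingQuadric.isMinimal_of_isPartOfLagrangianCatenoid hM hsa hS hJo hr hrpos h
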